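/- Let $R\subset\mathbb{R}^N\setminus\{0\}$ be a root system, i.e. a finite set with $R\cap\mathbb{R}\alpha=\{\alpha,-\alpha\}$ and $\sigma_\alpha(R)=R$ for all $\alpha\in R$, where $\sigma_\alpha x=x-2\frac{\langle\alpha,x\rangle}{\langle\alpha,\alpha\rangle}\alpha$; assume it normalised by $|\alpha|^2=2$ for all $\alpha\in R$. Let $G$ be the finite group generated by the reflections $\sigma_\alpha$, $\alpha \in R$, let $R_+$ be a positive subsystem (the roots on one side of a hyperplane through $0$ that contains no root), let $k:R\to[0,\infty)$ be $G$-invariant, and put $\gamma=\sum_{\alpha\in R_+}k_\alpha$. The Dunkl operators are $$T_if(x)=\partial_if(x)+\sum_{\alpha\in R_+}k_\alpha\alpha_i\frac{f(x)-f(\sigma_\alpha x)}{\langle\alpha,x\rangle},\qquad 1\le i\le N,$$ where for $\langle\alpha,x\rangle=0$ the quotient means its limit $\langle\alpha,\nabla f(x)\rangle$. Put $\nabla_k=(T_1,\dots,T_N)$ and $\Delta_k=\sum_iT_i^2$. Let $b=(b_1,\dots,b_N)$ with $b_i\in C^1(\mathbb{R}^N)$, let $L=\Delta_k+b\cdot\nabla_k$,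 and let $\tilde\Gamma(f)(x)=\sum_{g\in G}|\nabla_kf(gx)|^2$. Let $(P_t)_{t\ge0}$ be a Markov semigroup on $C_b(\mathbb{R}^N)$ (a semigroup of positivity preserving linear operators with $P_0=\mathrm{id}$ and $P_t1=1$) generated by $L$, in the sense that $\frac1t(P_tf-f)\to Lf$ uniformly as $t\to0^+$ for every $f\in C_c^\infty(\mathbb{R}^N)$. A Lyapunov function for $L$ is a function $\rho:\mathbb{R}^N\to[0,\infty]$ that is smooth (continuous into $[0,\infty]$ and $C^\infty$ on the open set $\{\rho<\infty\}$) and such that (i) $\{\rho<\infty\}\ne\emptyset$; (ii) $\{\rho\le M\}$ is compact for every $M>0$; (iii) there are constants $C_1\ge0$ and $C_2>0$ such that $L\rho(x)\le C_1-C_2\rho(x)$ for all $x$ with $\rho(x)<\infty$. (For $L\rho(x)$ to be defined at all such $x$, it is part of (iii) that $\rho(x)<\infty$ implies $\rho(\sigma_\alpha x)<\infty$ for all $\alpha\in R_+$ with $k_\alpha\neq0$.) **Theorem.** Let $\gamma<\frac12$. Assume that there is $\eta<0$ such that for all $f\in C_c^\infty(\mathbb{R}^N)$ and all $t>0$ the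 function $P_tf$ is $C^1$ and $$\tilde\Gamma(P_tf)\le e^{2\eta t}P_t(\tilde\Gamma(f))$$ pointwise on $\mathbb{R}^N$. Assume moreover that there is a Lyapunov function $\rho$ for $L$. Then there exist a sequence $t_l\to\infty$ and a probability measure $\nu$ on $\mathbb{R}^N$ such that for every bounded continuous $f$ and every $x\in\mathbb{R}^N$ with $\rho(x)<\infty$, $$P_{t_l}f(x)\to\int f\,d\nu\qquad\text{as } l\to\infty.$$ Moreover, $\nu$ is invariant for the semigroup: $\int P_tf\,d\nu=\int f\,d\nu$ for all $t\ge0$ and all bounded continuous $f$. -/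

import Mathlib

open Filter Topology MeasureTheory
open scoped NNReal ENNReal ContDiff BoundedContinuousFunction

noncomputable section

namespace Dunkl

/-- The Euclidean space `ℝ^N`. -/
abbrev E (N : ℕ) : Type := EuclideanSpace ℝ (Fin N)

/-- The orthogonal reflection `σ_α x = x - 2 ⟨α, x⟩ / ⟨α, α⟩ α` in the hyperplane orthogonal
to `α`. -/
def refl {N : ℕ} (α : E N) : E N ≃ₗᵢ[ℝ] E N :=
  ((Submodule.span ℝ {α})ᗮ).reflection

/-- The group generated by the reflections `σ_α`, `α ∈ R`. -/
def reflectionGroup {N : ℕ} (R : Finset (E N)) : Subgroup (E N ≃ₗᵢ[ℝ] E N) :=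
  Subgroup.closure {g | ∃ α ∈ R, g = refl α}

/-- A normalised root system `R` in `ℝ^N`, a positive subsystem `R₊` and a nonnegative
multiplicity function `k` (only its values on `R` matter). -/
structure RootData (N : ℕ) where
  /-- the root system -/
  R : Finset (E N)
  zero_notMem : (0 : E N) ∉ R
  /-- `R ∩ ℝα = {α, -α}` -/
  smul_mem_iff : ∀ α ∈ R, ∀ c : ℝ, c • α ∈ R ↔ c = 1 ∨ c = -1
  refl_mem : ∀ α ∈ R, ∀ β ∈ R, refl α β ∈ R
  norm_sq : ∀ α ∈ R, ‖α‖ ^ 2 = 2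
  /-- the positive subsystem: the roots on one side of a hyperplane which contains no root -/
  Rplus : Finset (E N)
  exists_hyperplane : ∃ v : E N, (∀ α ∈ R, inner ℝ v α ≠ 0) ∧
    ∀ α, α ∈ Rplus ↔ α ∈ R ∧ 0 < inner ℝ v α
  /-- the multiplicity function -/
  k : E N → ℝ
  k_nonneg : ∀ α ∈ R, 0 ≤ k α
  k_invariant : ∀ g ∈ reflectionGroup R, ∀ α ∈ R, k (g α) = k α

namespace RootData

variable {N : ℕ} (D : RootData N)

/-- The reflection group `G` of the root system. -/
abbrev G : Subgroup (E N ≃ₗᵢ[ℝ] E N) := reflectionGroup D.R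

theorem G_map_root {g : E N ≃ₗᵢ[ℝ] E N} (hg : g ∈ D.G) : ∀ β ∈ D.R, g β ∈ D.R := by
  induction hg using Subgroup.closure_induction with
  | mem x hx =>
    obtain ⟨α, hα, rfl⟩ := hx
    exact D.refl_mem α hα
  | one => intro β hβ; simpa using hβ
  | mul x y _ _ hx hy => intro β hβ; exact hx _ (hy _ hβ)
  | inv x _ hx =>
    intro β hβ
    have hinj : Set.InjOn x (D.R : Set (E N)) := x.injective.injOn
    obtain ⟨γ, hγ, rfl⟩ := Finset.surjOn_of_injOn_of_card_le x hx hinj le_rfl hβ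
    have : x⁻¹ (x γ) = γ := x.symm_apply_apply γ
    rw [this]; exact hγ

theorem G_fix {g : E N ≃ₗᵢ[ℝ] E N} (hg : g ∈ D.G) :
    ∀ x ∈ (Submodule.span ℝ (D.R : Set (E N)))ᗮ, g x = x := by
  induction hg using Subgroup.closure_induction with
  | mem y hy =>
    obtain ⟨α, hα, rfl⟩ := hy
    intro x hx
    refine Submodule.reflection_mem_subspace_eq_self ?_
    exact Submodule.orthogonal_le (Submodule.span_mono (by simpa using hα)) hx
  | one => intro x _; rfl
  | mul y z _ _ hy hz =>
    intro x hx
    change y (z x) = x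
    rw [hz x hx, hy x hx]
  | inv y _ hy =>
    intro x hx
    have : y⁻¹ (y x) = x := y.symm_apply_apply x
    rwa [hy x hx] at this

instance finite_G : Finite D.G := by
  let F : D.G → (D.R → D.R) := fun g r => ⟨g.1 r.1, D.G_map_root g.2 r.1 r.2⟩
  refine Finite.of_injective F fun g h hgh => ?_
  have hR : ∀ r ∈ D.R, g.1 r = h.1 r := fun r hr =>
    congrArg Subtype.val (congrFun hgh ⟨r, hr⟩)
  have hspan : ∀ x ∈ Submodule.span ℝ (D.R : Set (E N)), g.1 x = h.1 x := by
    intro x hx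
    induction hx using Submodule.span_induction with
    | mem x hx => exact hR x hx
    | zero => simp
    | add x y _ _ hx hy => simp [hx, hy]
    | smul c x _ hx => simp [hx]
  ext1
  ext1 x
  obtain ⟨y, hy, z, hz, rfl⟩ :=
    (Submodule.span ℝ (D.R : Set (E N))).exists_add_mem_mem_orthogonal x
  rw [map_add, map_add, hspan y hy, D.G_fix g.2 z hz, D.G_fix h.2 z hz]

instance fintype_G : Fintype D.G := Fintype.ofFinite _

/-- `γ = ∑_{α ∈ R₊} k_α`. -/
def gamma : ℝ := ∑ α ∈ D.Rplus, D.k α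

end RootData

variable {N : ℕ}

/-- The difference quotient `(f x - f (σ_α x)) / ⟨α, x⟩`, extended to the hyperplane
`⟨α, x⟩ = 0` by its limit, the directional derivative of `f` along `α` (here `|α|² = 2`). -/
def diffQuot (α : E N) (f : E N → ℝ) (x : E N) : ℝ :=
  open Classical in
  if inner ℝ α x = 0 then fderiv ℝ f x α else (f x - f (refl α x)) / inner ℝ α x

/-- The Dunkl operator `T_i`. -/
def T (D : RootData N) (i : Fin N) (f : E N → ℝ) (x : E N) : ℝ :=
  fderiv ℝ f x (EuclideanSpace.single i 1) + ∑ α ∈ D.Rplus, D.k α * α i * diffQuot α f x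

/-- The symmetrised gradient form `∑_{g ∈ G} |∇_k f (g x)|²`. -/
def symGrad (D : RootData N) (f : E N → ℝ) (x : E N) : ℝ :=
  ∑ g : D.G, ∑ i : Fin N, (T D i f (g.1 x)) ^ 2

/-- The operator `L = ∑ i, (T_i² + b_i T_i) = Δ_k + b · ∇_k`. -/
def L (D : RootData N) (b : E N → E N) (f : E N → ℝ) (x : E N) : ℝ :=
  ∑ i : Fin N, (T D i (T D i f) x + b x i * T D i f x)

/-- A smooth function with compact support, for `f` in `C_b(ℝ^N)`. -/
def IsTest (f : E N →ᵇ ℝ) : Prop :=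
  ContDiff ℝ ∞ (f : E N → ℝ) ∧ HasCompactSupport (f : E N → ℝ)

/-- A Markov semigroup on `C_b(ℝ^N)`: a semigroup of positivity preserving linear operators
which fix the constant function `1` (they are then contractions). -/
structure MarkovSemigroup (N : ℕ) where
  /-- the operators `P_t` -/
  P : ℝ≥0 → (E N →ᵇ ℝ) →ₗ[ℝ] (E N →ᵇ ℝ)
  zero : ∀ f, P 0 f = f
  add : ∀ s t f, P (s + t) f = P s (P t f)
  one : ∀ t, P t (BoundedContinuousFunction.const (E N) 1) =
    BoundedContinuousFunction.const (E N) 1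
  nonneg : ∀ t f, (∀ x, 0 ≤ f x) → ∀ x, 0 ≤ P t f x

/-- The generator of the semigroup is given by `L` on test functions:
`(P_t f - f) / t → L f` in supremum norm as `t → 0+`. -/
def MarkovSemigroup.IsGeneratedBy (S : MarkovSemigroup N) (D : RootData N) (b : E N → E N) :
    Prop :=
  ∀ f : E N →ᵇ ℝ, IsTest f →
    TendstoUniformly (fun (t : ℝ≥0) (x : E N) => (S.P t f x - f x) / (t : ℝ))
      (L D b f) (𝓝[>] 0)

/-- The gradient bound `Γ̃(P_t f) ≤ e^{2ηt} P_t(Γ̃ f)` for all `t > 0` and all test functions `f`;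
it includes that `P_t f` is `C¹`, so that the left side makes sense. The function `g` is
`Γ̃ f`, viewed as an element of `C_b(ℝ^N)`. -/
def MarkovSemigroup.GradientBound (S : MarkovSemigroup N) (D : RootData N) (η : ℝ) : Prop :=
  ∀ f : E N →ᵇ ℝ, IsTest f → ∀ g : E N →ᵇ ℝ, (∀ x, g x = symGrad D f x) →
    ∀ t : ℝ≥0, 0 < t → ContDiff ℝ 1 (S.P t f : E N → ℝ) ∧
      ∀ x, symGrad D (S.P t f) x ≤ Real.exp (2 * η * t) * S.P t g x

/-- A Lyapunov function `ρ : ℝ^N → [0, ∞]` for `L`. Smoothness means that `ρ` is continuous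
into `[0, ∞]` and `C^∞` on the open set where it is finite. The field `refl_ne_top` says that
`L ρ` is meaningful wherever `ρ` is finite: it involves the values of `ρ` at the points
`σ_α x` with `k_α ≠ 0`. -/
structure IsLyapunov (D : RootData N) (b : E N → E N) (ρ : E N → ℝ≥0∞) : Prop where
  continuous : Continuous ρ
  smooth : ContDiffOn ℝ ∞ (fun x => (ρ x).toReal) {x | ρ x ≠ ⊤}
  exists_ne_top : ∃ x, ρ x ≠ ⊤
  isCompact_le : ∀ M : ℝ≥0, 0 < M → IsCompact {x | ρ x ≤ (M : ℝ≥0∞)}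
  refl_ne_top : ∀ α ∈ D.Rplus, D.k α ≠ 0 → ∀ x, ρ x ≠ ⊤ → ρ (refl α x) ≠ ⊤
  drift : ∃ C₁ C₂ : ℝ, 0 ≤ C₁ ∧ 0 < C₂ ∧ ∀ x, ρ x ≠ ⊤ →
    L D b (fun y => (ρ y).toReal) x ≤ C₁ - C₂ * (ρ x).toReal

/-- `ν` is invariant for the semigroup: `∫ P_t f dν = ∫ f dν` for all `t` and `f ∈ C_b`. -/
def MarkovSemigroup.IsInvariant (S : MarkovSemigroup N) (ν : Measure (E N)) : Prop :=
  ∀ (t : ℝ≥0) (f : E N →ᵇ ℝ), ∫ x, S.P t f x ∂ν = ∫ x, f x ∂ν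

end Dunkl

end

noncomputable section

namespace Dunkl

variable {N : ℕ}

/-! Two mechanisms combine: `P_t f` becomes flat, and the functionals `f ↦ P_t f x` stay tight.

Flatness (`norm_fderiv_le`): solving the definition of `T_i` for the ordinary derivative leaves
difference quotients, which on a centred ball are at most `|α|` times the maximum `s` of `|∇h|`. As
`|α|² = 2`, this yields `s ≤ C + 2γs`, absorbed because `γ < 1/2`. The gradient bound then makes
`P_t f` Lipschitz with constant of order `e^{ηt}` for test functions `f`.

Tightness (`IsLyapunov.exists_bound`): formally, `P_t √(1+ρ)` stays bounded in `t` wherever `ρ` is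
finite. The generator is known only on test functions, so `ρ` enters through concave truncations `Φ
∘ ρ`, and `L(Φ ∘ ρ) ≤ Φ'(ρ) Lρ` follows from the positive maximum principle. Truncation destroys the
dissipation at large `ρ`; for the square root the loss is paid by a truncation of `1 + ρ`, whose
mean grows at most linearly in `t`, with a weight vanishing as the truncation level grows.

Convergence (`Flattens.exists_invariant`): `P_{s+t} f x - P_t f x` is `P_s` of a function small on
compact sets, so tightness gives a Cauchy net in `t`. Flatness makes the limit independent of `x`,
and tightness with Riesz–Markov makes it an integral. -/

/-! ### Dunkl operators: nonlocality, regular points, continuity. -/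

theorem refl_apply {α : E N} (hα : ‖α‖ ^ 2 = 2) (x : E N) :
    refl α x = x - (inner ℝ α x) • α := by
  rw [refl, Submodule.reflection_orthogonal_apply, Submodule.reflection_singleton_apply]
  simp only [RCLike.ofReal_real_eq_id, id_eq, hα]
  rw [two_smul, ← add_smul, neg_sub]
  congr 2
  ring

theorem RootData.mem_R {D : RootData N} {α : E N} (h : α ∈ D.Rplus) : α ∈ D.R := by
  obtain ⟨v, -, hv⟩ := D.exists_hyperplane
  exact ((hv α).1 h).1

theorem RootData.k_nonneg_of_mem {D : RootData N} {α : E N} (h : α ∈ D.Rplus) : 0 ≤ D.k α :=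
  D.k_nonneg α (D.mem_R h)

theorem RootData.norm_sq_of_mem {D : RootData N} {α : E N} (h : α ∈ D.Rplus) : ‖α‖ ^ 2 = 2 :=
  D.norm_sq α (D.mem_R h)

theorem RootData.refl_mem_G {D : RootData N} {α : E N} (h : α ∈ D.Rplus) : refl α ∈ D.G :=
  Subgroup.subset_closure ⟨α, D.mem_R h, rfl⟩

/-- A set stable under all reflections `σ_α` that occur in the Dunkl operators. -/
def ReflStable (D : RootData N) (V : Set (E N)) : Prop :=
  ∀ α ∈ D.Rplus, D.k α ≠ 0 → ∀ x ∈ V, refl α x ∈ V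

theorem ReflStable.inter {D : RootData N} {V W : Set (E N)} (hV : ReflStable D V)
    (hW : ReflStable D W) : ReflStable D (V ∩ W) :=
  fun α hα hk x hx => ⟨hV α hα hk x hx.1, hW α hα hk x hx.2⟩

theorem diffQuot_congr {α : E N} {f g : E N → ℝ} {x : E N} (h : f =ᶠ[𝓝 x] g)
    (hα : f (refl α x) = g (refl α x)) : diffQuot α f x = diffQuot α g x := by
  rw [diffQuot, diffQuot, h.fderiv_eq, h.eq_of_nhds, hα]

/-- Dunkl operators are nonlocal: agreement near `x` is not enough, since `σ_α x` enters. Roots with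
`k_α = 0` may be ignored, which matters because `ρ` may be infinite at their reflections. -/
theorem T_congr {D : RootData N} {V : Set (E N)} (hVo : IsOpen V) (hV : ReflStable D V)
    {f g : E N → ℝ} (h : Set.EqOn f g V) (i : Fin N) : Set.EqOn (T D i f) (T D i g) V := by
  intro x hx
  have hx' : f =ᶠ[𝓝 x] g := h.eventuallyEq_of_mem (hVo.mem_nhds hx)
  rw [T, T, hx'.fderiv_eq]
  congr 1
  refine Finset.sum_congr rfl fun α hα => ?_
  by_cases hk : D.k α = 0
  · simp [hk]
  · rw [diffQuot_congr hx' (h (hV α hα hk x hx))]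

theorem L_congr {D : RootData N} {V : Set (E N)} (hVo : IsOpen V) (hV : ReflStable D V)
    {f g : E N → ℝ} (h : Set.EqOn f g V) (b : E N → E N) : Set.EqOn (L D b f) (L D b g) V := by
  intro x hx
  rw [L, L]
  refine Finset.sum_congr rfl fun i _ => ?_
  rw [T_congr hVo hV h i hx, T_congr hVo hV (T_congr hVo hV h i) i hx]

theorem T_add_const (D : RootData N) (i : Fin N) (f : E N → ℝ) (c : ℝ) :
    T D i (fun x => f x + c) = T D i f := by
  funext x
  simp only [T, diffQuot, fderiv_add_const, add_sub_add_right_eq_sub]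

theorem L_add_const (D : RootData N) (b : E N → E N) (f : E N → ℝ) (c : ℝ) :
    L D b (fun x => f x + c) = L D b f := by
  funext x
  simp only [L, T_add_const]

/-- The set of points that lie on no reflecting hyperplane. -/
def regular (D : RootData N) : Set (E N) := {x | ∀ α ∈ D.R, inner ℝ α x ≠ 0}

theorem isOpen_regular (D : RootData N) : IsOpen (regular D) := by
  have : regular D = ⋂ α ∈ D.R, {x | inner ℝ α x ≠ 0} := by ext; simp [regular]
  rw [this]
  exact isOpen_biInter_finset fun α _ => isOpen_ne_fun (by fun_prop) (by fun_prop)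

theorem reflStable_regular (D : RootData N) : ReflStable D (regular D) := by
  intro α hα _ x hx β hβ
  have h := hx _ (D.refl_mem α (D.mem_R hα) β hβ)
  rwa [← (refl α).inner_map_map, refl, Submodule.reflection_reflection] at h

theorem dense_regular (D : RootData N) : Dense (regular D) := by
  have : regular D = ⋂ α ∈ D.R, {x | inner ℝ α x ≠ 0} := by ext; simp [regular]
  rw [this]
  refine dense_biInter_of_isOpen
    (fun α _ => isOpen_ne_fun (by fun_prop) (by fun_prop)) D.R.countable_toSet fun α hα => ?_
  have h0 : α ≠ 0 := fun h => D.zero_notMem (h ▸ hα)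
  let K : Submodule ℝ (E N) := LinearMap.ker (innerSL ℝ α).toLinearMap
  have hK : K ≠ ⊤ := fun h => by
    have : α ∈ K := h ▸ Submodule.mem_top
    simp [K, h0] at this
  have hc : {x | inner ℝ α x ≠ 0} = (K : Set (E N))ᶜ := by ext; simp [K]
  rw [hc, ← interior_eq_empty_iff_dense_compl]
  by_contra hne
  exact hK (K.eq_top_of_nonempty_interior' (Set.nonempty_iff_ne_empty.2 hne))

theorem diffQuot_of_regular {D : RootData N} {α : E N} (hα : α ∈ D.Rplus) (f : E N → ℝ) {x : E N}
    (hx : x ∈ regular D) : diffQuot α f x = (f x - f (refl α x)) / inner ℝ α x := by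
  rw [diffQuot, if_neg (hx α (D.mem_R hα))]

/-- Off the hyperplanes the quotient has a nonvanishing denominator, so smoothness survives and
`T_i` can be iterated. Second-order calculus is done only there; density of the regular set recovers
the other points. -/
theorem contDiffOn_T {D : RootData N} {W : Set (E N)} (hWo : IsOpen W) (hW : ReflStable D W)
    (hreg : W ⊆ regular D) {f : E N → ℝ} (hf : ContDiffOn ℝ ∞ f W) (i : Fin N) :
    ContDiffOn ℝ ∞ (T D i f) W := by
  refine ContDiffOn.add ?_ (ContDiffOn.sum fun α hα => ?_)
  · exact (hf.fderiv_of_isOpen hWo (by simp)).clm_apply contDiffOn_const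
  · by_cases hk : D.k α = 0
    · simpa [hk] using contDiffOn_const
    · refine contDiffOn_const.mul (ContDiffOn.congr ?_ fun x hx =>
        diffQuot_of_regular hα f (hreg hx))
      refine ContDiffOn.div (hf.sub ?_) (innerSL ℝ α).contDiff.contDiffOn fun x hx => hreg hx α (D.mem_R hα)
      exact hf.comp (refl α).contDiff.contDiffOn fun x hx => hW α hα hk x hx

theorem T_add_smul {D : RootData N} {W : Set (E N)} (hWo : IsOpen W)
    (hreg : W ⊆ regular D) {f g : E N → ℝ} (hf : ContDiffOn ℝ ∞ f W) (hg : ContDiffOn ℝ ∞ g W)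
    (c : ℝ) (i : Fin N) :
    Set.EqOn (T D i (fun x => c * f x + g x)) (fun x => c * T D i f x + T D i g x) W := by
  intro x hx
  have hf' : DifferentiableAt ℝ f x :=
    (hf.contDiffAt (hWo.mem_nhds hx)).differentiableAt (by simp)
  have hg' : DifferentiableAt ℝ g x :=
    (hg.contDiffAt (hWo.mem_nhds hx)).differentiableAt (by simp)
  have hfd : fderiv ℝ (fun x => c * f x + g x) x = c • fderiv ℝ f x + fderiv ℝ g x := by
    rw [fderiv_fun_add (hf'.const_mul c) hg', fderiv_const_mul hf']
  have hsum : ∀ α ∈ D.Rplus, D.k α * α i * diffQuot α (fun x => c * f x + g x) x =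
      c * (D.k α * α i * diffQuot α f x) + D.k α * α i * diffQuot α g x := by
    intro α hα
    simp only [diffQuot_of_regular hα _ (hreg hx)]
    ring
  simp only [T]
  rw [hfd, Finset.sum_congr rfl hsum, Finset.sum_add_distrib, ← Finset.mul_sum]
  simp only [add_apply, smul_apply, smul_eq_mul]
  ring

theorem L_add_smul {D : RootData N} {W : Set (E N)} (hWo : IsOpen W) (hW : ReflStable D W)
    (hreg : W ⊆ regular D) {f g : E N → ℝ} (hf : ContDiffOn ℝ ∞ f W) (hg : ContDiffOn ℝ ∞ g W)
    (b : E N → E N) (c : ℝ) :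
    Set.EqOn (L D b (fun x => c * f x + g x)) (fun x => c * L D b f x + L D b g x) W := by
  intro x hx
  simp only [L]
  rw [Finset.mul_sum, ← Finset.sum_add_distrib]
  refine Finset.sum_congr rfl fun i _ => ?_
  rw [T_congr hWo hW (T_add_smul hWo hreg hf hg c i) i hx,
    T_add_smul hWo hreg (contDiffOn_T hWo hW hreg hf i) (contDiffOn_T hWo hW hreg hg i) c i hx,
    T_add_smul hWo hreg hf hg c i hx]
  ring

theorem continuous_diffQuot {α : E N} (hα : ‖α‖ ^ 2 = 2) {f : E N → ℝ} (hf : ContDiff ℝ 1 f) :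
    Continuous (diffQuot α f) := by
  refine continuous_iff_continuousAt.2 fun x₀ => ?_
  have hin : Continuous fun x : E N => inner ℝ α x := by fun_prop
  by_cases h0 : inner ℝ α x₀ = 0
  · have hx₀ : refl α x₀ = x₀ := by rw [refl_apply hα, h0]; simp
    have hval : diffQuot α f x₀ = fderiv ℝ f x₀ α := by rw [diffQuot, if_pos h0]
    -- Strict differentiability is needed because both endpoints `x` and `σ_α x` move as they
    -- approach `x₀`.
    have hstrict := (hf.contDiffAt (x := x₀)).hasStrictFDerivAt (by simp)
    rw [ContinuousAt, hval, Metric.tendsto_nhds]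
    intro ε hε
    have hαn : 0 < ‖α‖ := by
      rcases (norm_nonneg α).lt_or_eq with h | h
      · exact h
      · rw [← h] at hα; norm_num at hα
    have h1 := hstrict.isLittleO.def (c := ε / (2 * ‖α‖)) (by positivity)
    have htend : Tendsto (fun x => (x, refl α x)) (𝓝 x₀) (𝓝 (x₀, x₀)) := by
      have : Continuous fun x => (x, refl α x) :=
        continuous_id.prodMk (refl α).continuous
      simpa [hx₀] using this.tendsto x₀
    have h2 : ∀ᶠ x in 𝓝 x₀, dist (fderiv ℝ f x α) (fderiv ℝ f x₀ α) < ε := by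
      have : Continuous fun x => fderiv ℝ f x α :=
        (hf.continuous_fderiv (by simp)).clm_apply continuous_const
      exact Metric.tendsto_nhds.1 (this.tendsto x₀) ε hε
    filter_upwards [htend.eventually h1, h2] with x hx hx2
    by_cases hx0 : inner ℝ α x = 0
    · rwa [diffQuot, if_pos hx0]
    · rw [diffQuot, if_neg hx0]
      have hsub : x - refl α x = (inner ℝ α x : ℝ) • α := by rw [refl_apply hα]; abel
      rw [hsub, map_smul, norm_smul, smul_eq_mul, Real.norm_eq_abs, Real.norm_eq_abs] at hx
      have habs : 0 < |(inner ℝ α x : ℝ)| := abs_pos.2 hx0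
      rw [Real.dist_eq, show (f x - f (refl α x)) / inner ℝ α x - fderiv ℝ f x₀ α =
        (f x - f (refl α x) - inner ℝ α x * fderiv ℝ f x₀ α) / inner ℝ α x by field_simp,
        abs_div, div_lt_iff₀ habs]
      refine hx.trans_lt ?_
      rw [show ε / (2 * ‖α‖) * (|(inner ℝ α x : ℝ)| * ‖α‖) = ε * |(inner ℝ α x : ℝ)| / 2 by
        field_simp]
      have := mul_pos hε habs
      linarith
  · have hne : ∀ᶠ x in 𝓝 x₀, inner ℝ α x ≠ (0 : ℝ) := hin.continuousAt.eventually_ne h0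
    have hc : ContinuousAt (fun x => (f x - f (refl α x)) / inner ℝ α x) x₀ :=
      ((hf.continuous.sub (hf.continuous.comp (refl α).continuous)).continuousAt).div
        hin.continuousAt h0
    refine hc.congr ?_
    filter_upwards [hne] with x hx
    rw [diffQuot, if_neg hx]

theorem continuous_T (D : RootData N) {f : E N → ℝ} (hf : ContDiff ℝ 1 f) (i : Fin N) :
    Continuous (T D i f) := by
  refine Continuous.add ?_ (continuous_finsetSum _ fun α hα => ?_)
  · exact (hf.continuous_fderiv (by simp)).clm_apply continuous_const
  · exact continuous_const.mul (continuous_diffQuot (D.norm_sq_of_mem hα) hf)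

theorem continuous_symGrad (D : RootData N) {f : E N → ℝ} (hf : ContDiff ℝ 1 f) :
    Continuous (symGrad D f) := by
  refine continuous_finsetSum _ fun g _ => continuous_finsetSum _ fun i _ => ?_
  exact ((continuous_T D hf i).comp g.1.continuous).pow 2

theorem reflStable_compl_closedBall (D : RootData N) (r : ℝ) :
    ReflStable D (Metric.closedBall (0 : E N) r)ᶜ := by
  intro α _ _ x hx
  simpa using hx

theorem T_zero (D : RootData N) (i : Fin N) (x : E N) : T D i (fun _ => 0) x = 0 := by
  simp [T, diffQuot]

/-- A function in `C_b` from a continuous function with compact support. -/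
theorem exists_bcf_of_hasCompactSupport {f : E N → ℝ} (hf : Continuous f)
    (hs : HasCompactSupport f) : ∃ F : E N →ᵇ ℝ, ∀ x, F x = f x := by
  obtain ⟨C, hC⟩ := hs.exists_bound_of_continuous hf
  exact ⟨BoundedContinuousFunction.ofNormedAddCommGroup f hf C hC, fun x => rfl⟩

theorem exists_bcf_symGrad (D : RootData N) {f : E N →ᵇ ℝ} (hf : IsTest f) :
    ∃ g : E N →ᵇ ℝ, ∀ x, g x = symGrad D f x := by
  refine exists_bcf_of_hasCompactSupport (continuous_symGrad D (hf.1.of_le (by simp))) ?_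
  obtain ⟨r, hr⟩ := hf.2.isBounded.subset_closedBall (0 : E N)
  refine HasCompactSupport.intro (isCompact_closedBall (0 : E N) r) fun x hx => ?_
  have hz : Set.EqOn f (fun _ => 0) (Metric.closedBall (0 : E N) r)ᶜ := fun y hy =>
    image_eq_zero_of_notMem_tsupport fun h => hy (hr h)
  refine Finset.sum_eq_zero fun g _ => Finset.sum_eq_zero fun i _ => ?_
  have hgx : g.1 x ∈ (Metric.closedBall (0 : E N) r)ᶜ := by simpa using hx
  rw [T_congr Metric.isClosed_closedBall.isOpen_compl (reflStable_compl_closedBall D r) hz i hgx,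
    T_zero]
  simp


/-! ### Markov semigroups: positivity, maximum principle, Gronwall. -/

namespace MarkovSemigroup

variable (S : MarkovSemigroup N)

theorem mono (t : ℝ≥0) {f g : E N →ᵇ ℝ} (h : ∀ x, f x ≤ g x) (x : E N) : S.P t f x ≤ S.P t g x := by
  have := S.nonneg t (g - f) (fun y => by simpa using h y) x
  simpa using this

theorem P_const (t : ℝ≥0) (c : ℝ) :
    S.P t (BoundedContinuousFunction.const (E N) c) = BoundedContinuousFunction.const (E N) c := by
  have : BoundedContinuousFunction.const (E N) c =
      c • BoundedContinuousFunction.const (E N) (1 : ℝ) := by ext; simp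
  rw [this, map_smul, S.one]

theorem P_const_apply (t : ℝ≥0) (c : ℝ) (x : E N) :
    S.P t (BoundedContinuousFunction.const (E N) c) x = c := by
  rw [P_const]; rfl

theorem P_le_of_le (t : ℝ≥0) {f : E N →ᵇ ℝ} {c : ℝ} (h : ∀ x, f x ≤ c) (x : E N) :
    S.P t f x ≤ c := by
  simpa [P_const_apply] using S.mono t (g := BoundedContinuousFunction.const (E N) c) h x

theorem abs_P_le (t : ℝ≥0) {f g : E N →ᵇ ℝ} (h : ∀ x, |f x| ≤ g x) (x : E N) :
    |S.P t f x| ≤ S.P t g x := by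
  refine abs_le.2 ⟨?_, S.mono t (fun y => (le_abs_self _).trans (h y)) x⟩
  have := S.mono t (f := -f) (g := g) (fun y => (neg_le_abs _).trans (h y)) x
  rw [map_neg] at this
  simp only [BoundedContinuousFunction.coe_neg, Pi.neg_apply] at this
  linarith

theorem abs_P_le_of_abs_le (t : ℝ≥0) {f : E N →ᵇ ℝ} {c : ℝ} (h : ∀ x, |f x| ≤ c) (x : E N) :
    |S.P t f x| ≤ c := by
  simpa [P_const_apply] using S.abs_P_le t (g := BoundedContinuousFunction.const (E N) c) h x

variable {S} {D : RootData N} {b : E N → E N}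

/-- `L f` is a uniform limit of bounded continuous functions, so no regularity of `b` or of iterated
Dunkl operators has to be examined. -/
theorem IsGeneratedBy.exists_bcf (hS : S.IsGeneratedBy D b) {f : E N →ᵇ ℝ} (hf : IsTest f) :
    ∃ l : E N →ᵇ ℝ, ∀ x, l x = L D b f x := by
  have h := hS f hf
  have hc : Continuous (L D b f) := h.continuous (Frequently.of_forall fun t =>
    ((S.P t f).continuous.sub f.continuous).div_const _)
  obtain ⟨t, ht⟩ := (Metric.tendstoUniformly_iff.1 h 1 one_pos).exists
  let q : E N →ᵇ ℝ := (t : ℝ)⁻¹ • (S.P t f - f)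
  refine ⟨BoundedContinuousFunction.ofNormedAddCommGroup (L D b f) hc (‖q‖ + 1) fun x => ?_,
    fun x => rfl⟩
  have h1 := (ht x).le
  have h2 : q x = (S.P t f x - f x) / (t : ℝ) := by simp [q, div_eq_inv_mul]
  rw [← h2, dist_eq_norm] at h1
  have h3 := q.norm_coe_le_norm x
  have h4 := norm_le_norm_add_norm_sub (q x) (L D b f x)
  rw [norm_sub_rev] at h4
  linarith

/-- The positive maximum principle. -/
theorem IsGeneratedBy.L_nonneg (hS : S.IsGeneratedBy D b) {f : E N →ᵇ ℝ} (hf : IsTest f)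
    (h0 : ∀ y, 0 ≤ f y) {x : E N} (hx : f x = 0) : 0 ≤ L D b f x := by
  refine ge_of_tendsto' ((hS f hf).tendsto_at x) fun t => ?_
  rw [hx, sub_zero]
  exact div_nonneg (S.nonneg t f h0 x) t.2

/-- The increment quotient is `P_s` applied to `(P_t f - f)/t`, and `P_s` is a contraction. -/
theorem IsGeneratedBy.tendsto_slope (hS : S.IsGeneratedBy D b) {f l : E N →ᵇ ℝ} (hf : IsTest f)
    (hl : ∀ x, l x = L D b f x) (s : ℝ≥0) (x : E N) :
    Tendsto (fun t : ℝ≥0 => (S.P (s + t) f x - S.P s f x) / t) (𝓝[>] 0) (𝓝 (S.P s l x)) := by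
  rw [Metric.tendsto_nhds]
  intro ε hε
  filter_upwards [Metric.tendstoUniformly_iff.1 (hS f hf) (ε / 2) (half_pos hε)] with t ht
  have key : |S.P s ((t : ℝ)⁻¹ • (S.P t f - f) - l) x| ≤ ε / 2 := by
    refine S.abs_P_le_of_abs_le s (fun y => ?_) x
    have := (ht y).le
    rw [dist_comm, Real.dist_eq, ← hl] at this
    simpa [div_eq_inv_mul] using this
  rw [map_sub, map_smul, map_sub, ← S.add] at key
  rw [Real.dist_eq]
  refine lt_of_le_of_lt ?_ (half_lt_self hε)
  simpa [div_eq_inv_mul] using key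

theorem IsGeneratedBy.continuous_orbit (hS : S.IsGeneratedBy D b) {f : E N →ᵇ ℝ} (hf : IsTest f)
    (x : E N) : Continuous fun s : ℝ≥0 => S.P s f x := by
  obtain ⟨l, hl⟩ := hS.exists_bcf hf
  have hsmall : ∀ᶠ t : ℝ≥0 in 𝓝[>] 0, ∀ y, |S.P t f y - f y| ≤ t * (‖l‖ + 1) := by
    filter_upwards [Metric.tendstoUniformly_iff.1 (hS f hf) 1 one_pos, self_mem_nhdsWithin]
      with t ht ht0 y
    have ht0' : (0 : ℝ) < t := ht0
    have h1 := (ht y).le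
    rw [dist_comm, Real.dist_eq, ← hl] at h1
    have h2 := l.norm_coe_le_norm y
    rw [Real.norm_eq_abs] at h2
    have h3 : |(S.P t f y - f y) / (t : ℝ)| ≤ ‖l‖ + 1 := by
      have := abs_sub_abs_le_abs_sub ((S.P t f y - f y) / (t : ℝ)) (l y)
      linarith
    rwa [abs_div, abs_of_pos ht0', div_le_iff₀ ht0', mul_comm] at h3
  have hincr : ∀ (C : ℝ) (s t : ℝ≥0), (∀ y, |S.P t f y - f y| ≤ C) →
      |S.P (s + t) f x - S.P s f x| ≤ C := by
    intro C s t h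
    have := S.abs_P_le_of_abs_le s (f := S.P t f - f) (c := C) (by simpa using h) x
    rw [map_sub, ← S.add] at this
    simpa using this
  rw [Metric.continuous_iff]
  intro s ε hε
  obtain ⟨δ, hδ, hδ'⟩ : ∃ δ : ℝ≥0, 0 < δ ∧ ∀ t : ℝ≥0, 0 < t → t < δ →
      ∀ y, |S.P t f y - f y| ≤ t * (‖l‖ + 1) := by
    rw [eventually_nhdsWithin_iff] at hsmall
    obtain ⟨δ, hδ, h⟩ := (nhds_bot_basis.mem_iff).1 hsmall
    exact ⟨δ, hδ, fun t h0 ht => h (show t < δ from ht) h0⟩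
  have hl0 : 0 < ‖l‖ + 1 := by positivity
  refine ⟨min δ (ε / (‖l‖ + 1)), lt_min (by exact_mod_cast hδ) (by positivity), fun r hr => ?_⟩
  have hdist : ∀ a t : ℝ≥0, (t : ℝ) < min (δ : ℝ) (ε / (‖l‖ + 1)) →
      |S.P (a + t) f x - S.P a f x| < ε := by
    intro a t ht
    rcases eq_or_lt_of_le (zero_le : 0 ≤ t) with h0 | h0
    · simpa [← h0] using hε
    · refine (hincr _ a t (hδ' t h0 (by exact_mod_cast (ht.trans_le (min_le_left _ _))))).trans_lt ?_
      exact (lt_div_iff₀ hl0).1 (ht.trans_le (min_le_right _ _))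
  rw [NNReal.dist_eq] at hr
  rcases le_total s r with h | h
  · have hr' : ((r - s : ℝ≥0) : ℝ) < min (δ : ℝ) (ε / (‖l‖ + 1)) := by
      rw [NNReal.coe_sub h]; exact (le_abs_self _).trans_lt hr
    have := hdist s (r - s) hr'
    rwa [add_tsub_cancel_of_le h, ← Real.dist_eq] at this
  · have hr' : ((s - r : ℝ≥0) : ℝ) < min (δ : ℝ) (ε / (‖l‖ + 1)) := by
      rw [NNReal.coe_sub h]; rw [abs_sub_comm] at hr; exact (le_abs_self _).trans_lt hr
    have := hdist r (s - r) hr'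
    rwa [add_tsub_cancel_of_le h, ← Real.dist_eq, dist_comm] at this

/-- A differential inequality for `P_s u` with `u = c - f` and `f` a test function. -/
theorem IsGeneratedBy.le_gronwallBound (hS : S.IsGeneratedBy D b) {f u H : E N →ᵇ ℝ} {c : ℝ}
    (hf : IsTest f) (hu : ∀ y, u y = c - f y) (hH : ∀ y, -L D b f y ≤ H y) (t : ℝ≥0) (x : E N)
    (K ε : ℝ) (hK : ∀ s ≤ t, S.P s H x ≤ K * S.P s u x + ε) :
    S.P t u x ≤ gronwallBound (u x) K ε t := by
  obtain ⟨l, hl⟩ := hS.exists_bcf hf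
  have hu' : u = BoundedContinuousFunction.const (E N) c - f := by ext y; simp [hu]
  have hPu : ∀ s, S.P s u x = c - S.P s f x := fun s => by
    rw [hu', map_sub]; simp [P_const_apply]
  -- Only right difference quotients are available, hence the one-sided Gronwall lemma. The right
  -- derivative of `P_s u x` is `-P_s(L f) x`, since `P_s` fixes constants.
  have hmain := le_gronwallBound_of_liminf_deriv_right_le
    (f := fun s : ℝ => S.P s.toNNReal u x) (f' := fun s : ℝ => -S.P s.toNNReal l x)
    (δ := u x) (K := K) (ε := ε) (a := 0) (b := t) ?_ ?_ ?_ ?_ t ⟨t.2, le_rfl⟩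
  · simpa using hmain
  · simp only [hPu]
    exact (continuous_const.sub ((hS.continuous_orbit hf x).comp continuous_real_toNNReal)).continuousOn
  · intro s hs r hr
    have h1 := (hS.tendsto_slope hf hl s.toNNReal x).neg
    have hmap : Tendsto (fun z : ℝ => (z - s).toNNReal) (𝓝[>] s) (𝓝[>] 0) := by
      refine tendsto_nhdsWithin_iff.2 ⟨?_, ?_⟩
      · have : Continuous fun z : ℝ => (z - s).toNNReal := by fun_prop
        have h := this.tendsto s
        simp only [sub_self, Real.toNNReal_zero] at h
        exact h.mono_left nhdsWithin_le_nhds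
      · filter_upwards [self_mem_nhdsWithin] with z hz
        simpa using hz
    refine Eventually.frequently ?_
    filter_upwards [(h1.comp hmap).eventually (gt_mem_nhds hr), self_mem_nhdsWithin] with z hz hzs
    have hzs' : s < z := hzs
    have e1 : s.toNNReal + (z - s).toNNReal = z.toNNReal := by
      rw [← Real.toNNReal_add hs.1 (sub_nonneg.2 hzs'.le)]; congr 1; ring
    simp only [Function.comp_apply, e1, Real.coe_toNNReal _ (sub_nonneg.2 hzs'.le)] at hz
    rw [hPu, hPu]
    refine lt_of_eq_of_lt ?_ hz
    ring
  · simp [S.zero]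
  · intro s hs
    have hst : s.toNNReal ≤ t := Real.toNNReal_le_iff_le_coe.2 hs.2.le
    refine le_trans ?_ (hK _ hst)
    have := S.mono s.toNNReal (f := -l) (g := H) (fun y => by simpa [hl] using hH y) x
    rw [map_neg] at this
    simpa using this

end MarkovSemigroup


/-! ### Truncations of a Lyapunov function and the chain rule inequality. -/

/-- A smooth concave truncation of the identity. -/
theorem exists_concave_truncation : ∃ (θ θ' : ℝ → ℝ) (m : ℝ), ContDiff ℝ ∞ θ ∧ Monotone θ ∧
    (∀ z ≤ 1, θ z = z) ∧ (∀ z ≤ 1, θ' z = 1) ∧ (∀ z, 2 ≤ z → θ z = m) ∧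
    (∀ z, 0 ≤ θ' z ∧ θ' z ≤ 1) ∧ ∀ z w, θ w ≤ θ z + θ' z * (w - z) := by
  -- This is the derivative of the truncation: it decreases from 1 to 0 on `[1, 2]`, so its
  -- primitive is concave.
  let χ : ℝ → ℝ := fun z => 1 - Real.smoothTransition (z - 1)
  have hχ : ContDiff ℝ ∞ χ := by
    have : ContDiff ℝ ∞ Real.smoothTransition := Real.smoothTransition.contDiff
    fun_prop
  have hχc : Continuous χ := hχ.continuous
  let θ : ℝ → ℝ := fun z => ∫ s in (0 : ℝ)..z, χ s
  have hd : ∀ z, HasDerivAt θ (χ z) z := fun z =>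
    intervalIntegral.integral_hasDerivAt_right (hχc.intervalIntegrable _ _)
      (hχc.stronglyMeasurableAtFilter _ _) hχc.continuousAt
  have hderiv : deriv θ = χ := funext fun z => (hd z).deriv
  have hdiff : Differentiable ℝ θ := fun z => (hd z).differentiableAt
  have hanti : Antitone χ := fun a b hab =>
    sub_le_sub_left (Real.smoothTransition.monotone (by linarith)) _
  have hχ01 : ∀ z, 0 ≤ χ z ∧ χ z ≤ 1 := fun z =>
    ⟨sub_nonneg.2 (Real.smoothTransition.le_one _),
      sub_le_self _ (Real.smoothTransition.nonneg _)⟩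
  have hχ1 : ∀ z ≤ 1, χ z = 1 := fun z hz => by
    simp [χ, Real.smoothTransition.zero_of_nonpos (sub_nonpos.2 hz)]
  have hχ2 : ∀ z, 2 ≤ z → χ z = 0 := fun z hz => by
    simp [χ, Real.smoothTransition.one_of_one_le (show (1 : ℝ) ≤ z - 1 by linarith)]
  refine ⟨θ, χ, θ 2, ?_, ?_, ?_, hχ1, ?_, hχ01, ?_⟩
  · rw [contDiff_infty_iff_deriv, hderiv]
    exact ⟨hdiff, hχ⟩
  · exact monotone_of_deriv_nonneg hdiff fun z => by rw [hderiv]; exact (hχ01 z).1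
  · intro z hz
    have : θ z = ∫ s in (0 : ℝ)..z, (1 : ℝ) := intervalIntegral.integral_congr fun s hs => by
      refine hχ1 s (hs.2.trans ?_)
      exact max_le zero_le_one hz
    simp [this]
  · intro z hz
    have h : θ z - θ 2 = ∫ s in (2 : ℝ)..z, χ s := intervalIntegral.integral_interval_sub_left
      (hχc.intervalIntegrable _ _) (hχc.intervalIntegrable _ _)
    have h0 : ∫ s in (2 : ℝ)..z, χ s = ∫ s in (2 : ℝ)..z, (0 : ℝ) :=
      intervalIntegral.integral_congr fun s hs => by
        rw [Set.uIcc_of_le hz] at hs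
        exact hχ2 s hs.1
    rw [h0, intervalIntegral.integral_zero] at h
    linarith
  · intro z w
    have h : θ w - θ z = ∫ s in z..w, χ s := intervalIntegral.integral_interval_sub_left
      (hχc.intervalIntegrable _ _) (hχc.intervalIntegrable _ _)
    have hle : ∫ s in z..w, χ s ≤ χ z * (w - z) := by
      rcases le_total z w with hzw | hzw
      · have := intervalIntegral.integral_mono_on hzw (hχc.intervalIntegrable _ _)
          (continuous_const.intervalIntegrable (μ := volume) z w) (g := fun _ => χ z)
          fun s hs => hanti hs.1
        simpa [mul_comm] using this
      · rw [intervalIntegral.integral_symm]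
        have := intervalIntegral.integral_mono_on hzw
          (continuous_const.intervalIntegrable (μ := volume) w z) (hχc.intervalIntegrable _ _)
          (f := fun _ => χ z) fun s hs => hanti hs.2
        simp only [intervalIntegral.integral_const, smul_eq_mul] at this
        linarith
    linarith

variable {D : RootData N} {b : E N → E N} {ρ : E N → ℝ≥0∞} {S : MarkovSemigroup N}

theorem IsLyapunov.isOpen_ne_top (hρ : IsLyapunov D b ρ) : IsOpen {x | ρ x ≠ ⊤} :=
  isOpen_ne_fun hρ.continuous continuous_const

/-- Near a point where `ρ = ⊤`, continuity forces `ρ > M`, so the composite vanishes there. The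
half-line `(-1, ∞)` contains the finite values of `ρ` and is where `√(1 + r)` is smooth. -/
theorem IsLyapunov.exists_test (hρ : IsLyapunov D b ρ) {Ψ : ℝ → ℝ} {M : ℝ}
    (hΨ : ContDiffOn ℝ ∞ Ψ (Set.Ioi (-1))) (h0 : ∀ r, M ≤ r → Ψ r = 0) :
    ∃ F : E N →ᵇ ℝ, IsTest F ∧ (∀ x, ρ x ≠ ⊤ → F x = Ψ (ρ x).toReal) ∧
      ∀ x, ρ x = ⊤ → F x = 0 := by
  classical
  let f : E N → ℝ := fun x => if ρ x = ⊤ then 0 else Ψ (ρ x).toReal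
  have hsmooth : ContDiff ℝ ∞ f := by
    refine contDiff_iff_contDiffAt.2 fun x => ?_
    by_cases hx : ρ x = ⊤
    · have hev : ∀ᶠ y in 𝓝 x, ENNReal.ofReal M < ρ y :=
        hρ.continuous.continuousAt.eventually (lt_mem_nhds (by simp [hx]))
      refine (contDiffAt_const (c := (0 : ℝ))).congr_of_eventuallyEq ?_
      filter_upwards [hev] with y hy
      by_cases hy' : ρ y = ⊤
      · simp [f, hy']
      · simp only [f, if_neg hy']
        exact h0 _ ((ENNReal.ofReal_le_iff_le_toReal hy').1 hy.le)
    · have hO := hρ.isOpen_ne_top.mem_nhds hx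
      have h1 : ContDiffAt ℝ ∞ (fun y => (ρ y).toReal) x := hρ.smooth.contDiffAt hO
      have h2 : ContDiffAt ℝ ∞ Ψ (ρ x).toReal := hΨ.contDiffAt
        (Ioi_mem_nhds (by linarith [ENNReal.toReal_nonneg (a := ρ x)]))
      refine (h2.comp x h1).congr_of_eventuallyEq ?_
      filter_upwards [hO] with y hy
      exact if_neg hy
  have hsupp : HasCompactSupport f := by
    refine HasCompactSupport.intro (hρ.isCompact_le (max M.toNNReal 1) (by positivity))
      fun x hx => ?_
    by_cases hx' : ρ x = ⊤
    · simp [f, hx']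
    · simp only [f, if_neg hx']
      refine h0 _ ((ENNReal.ofReal_le_iff_le_toReal hx').1 ?_)
      refine le_trans ?_ (not_le.1 hx).le
      exact ENNReal.coe_le_coe.2 (le_max_left _ _)
  obtain ⟨F, hF⟩ := exists_bcf_of_hasCompactSupport hsmooth.continuous hsupp
  have hFf : (F : E N → ℝ) = f := funext hF
  refine ⟨F, ⟨by rwa [hFf], by rwa [hFf]⟩, fun x hx => ?_, fun x hx => ?_⟩
  · rw [hF]; exact if_neg hx
  · rw [hF]; exact if_pos hx

/-- The group generated by the reflections with nonzero multiplicity. -/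
def activeGroup (D : RootData N) : Subgroup (E N ≃ₗᵢ[ℝ] E N) :=
  Subgroup.closure {g | ∃ α ∈ D.Rplus, D.k α ≠ 0 ∧ g = refl α}

theorem activeGroup_le (D : RootData N) : activeGroup D ≤ D.G := by
  refine (Subgroup.closure_le _).2 ?_
  rintro g ⟨α, hα, -, rfl⟩
  exact D.refl_mem_G hα

theorem IsLyapunov.map_eq_top_iff (hρ : IsLyapunov D b ρ) {g : E N ≃ₗᵢ[ℝ] E N}
    (hg : g ∈ activeGroup D) : ∀ x, ρ (g x) = ⊤ ↔ ρ x = ⊤ := by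
  induction hg using Subgroup.closure_induction with
  | mem g hg =>
    obtain ⟨α, hα, hk, rfl⟩ := hg
    intro x
    refine not_iff_not.1 ⟨fun h => ?_, hρ.refl_ne_top α hα hk x⟩
    have := hρ.refl_ne_top α hα hk _ h
    rwa [refl, Submodule.reflection_reflection] at this
  | one => intro x; rfl
  | mul g h _ _ hg hh => intro x; exact (hg (h x)).trans (hh x)
  | inv g _ hg =>
    intro x
    have : g (g⁻¹ x) = x := g.apply_symm_apply x
    rw [← hg (g⁻¹ x), this]

theorem IsLyapunov.exists_stable_nhd (hρ : IsLyapunov D b ρ) {x : E N} (hx : ρ x ≠ ⊤) :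
    ∃ (V : Set (E N)) (M : ℝ≥0), IsOpen V ∧ ReflStable D V ∧ x ∈ V ∧ ∀ y ∈ V, ρ y < M := by
  -- Points of the full orbit with `ρ = ⊤` contribute 0 to the sum; only the active group, which
  -- preserves finiteness of `ρ`, is used below.
  let M : ℝ≥0 := ∑ g : D.G, (ρ (g.1 x)).toNNReal + 1
  let V : Set (E N) := ⋂ g : {g : D.G // g.1 ∈ activeGroup D}, {y | ρ (g.1.1 y) < M}
  refine ⟨V, M, ?_, ?_, ?_, ?_⟩
  · exact isOpen_iInter_of_finite fun g =>
      isOpen_lt (hρ.continuous.comp g.1.1.continuous) continuous_const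
  · intro α hα hk y hy
    refine Set.mem_iInter.2 fun g => ?_
    have hmem : g.1.1 * refl α ∈ activeGroup D :=
      mul_mem g.2 (Subgroup.subset_closure ⟨α, hα, hk, rfl⟩)
    exact Set.mem_iInter.1 hy ⟨⟨g.1.1 * refl α, activeGroup_le D hmem⟩, hmem⟩
  · refine Set.mem_iInter.2 fun g => ?_
    have hne : ρ (g.1.1 x) ≠ ⊤ := fun h => hx ((hρ.map_eq_top_iff g.2 x).1 h)
    change ρ (g.1.1 x) < M
    rw [← ENNReal.coe_toNNReal hne, ENNReal.coe_lt_coe]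
    refine lt_of_le_of_lt ?_ (lt_add_one _)
    exact Finset.single_le_sum (f := fun g : D.G => (ρ (g.1 x)).toNNReal)
      (fun _ _ => zero_le) (Finset.mem_univ g.1)
  · intro y hy
    exact Set.mem_iInter.1 hy ⟨1, one_mem _⟩

/-- The chain rule inequality `L(Φ ∘ ρ) ≤ Φ'(ρ) Lρ` for `Φ` concave and constant near infinity,
at a regular point; `f = c - Φ ∘ ρ`. -/
theorem IsLyapunov.neg_L_le (hS : S.IsGeneratedBy D b) (hρ : IsLyapunov D b ρ) {x : E N}
    (hx : ρ x ≠ ⊤) (hxr : x ∈ regular D) {Φ : ℝ → ℝ} (hΦ : ContDiffOn ℝ ∞ Φ (Set.Ioi (-1)))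
    {c a : ℝ} (htan : ∀ s, 0 ≤ s → Φ s ≤ Φ (ρ x).toReal + a * (s - (ρ x).toReal))
    {f : E N →ᵇ ℝ} (hf : IsTest f) (hfΦ : ∀ y, ρ y ≠ ⊤ → f y = c - Φ (ρ y).toReal) :
    -L D b f x ≤ a * L D b (fun y => (ρ y).toReal) x := by
  obtain ⟨V, M, hVo, hV, hxV, hVM⟩ := hρ.exists_stable_nhd hx
  set r₀ := (ρ x).toReal
  -- The cutoff is 1 on `V`, where `ρ < M`, and 0 from `M + 1` on. It turns the nonnegative tangent
  -- gap, which vanishes at `x`, into a test function without changing `L` at `x`.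
  let ψ : ℝ → ℝ := fun r => 1 - Real.smoothTransition (r - M)
  let tangentGap : ℝ → ℝ := fun r => Φ r₀ + a * (r - r₀) - Φ r
  have hψ : ContDiff ℝ ∞ ψ := by
    have : ContDiff ℝ ∞ Real.smoothTransition := Real.smoothTransition.contDiff
    fun_prop
  have hgap : ContDiffOn ℝ ∞ tangentGap (Set.Ioi (-1)) :=
    ContDiffOn.sub (ContDiff.contDiffOn (by fun_prop)) hΦ
  obtain ⟨h, hh, hhfin, hhtop⟩ := hρ.exists_test (Ψ := fun r => ψ r * tangentGap r) (M := M + 1)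
    (hψ.contDiffOn.mul hgap) fun r hr => by
      simp [ψ, Real.smoothTransition.one_of_one_le (show (1 : ℝ) ≤ r - M by linarith)]
  have hh0 : ∀ y, 0 ≤ h y := fun y => by
    by_cases hy : ρ y = ⊤
    · rw [hhtop y hy]
    · rw [hhfin y hy]
      exact mul_nonneg (sub_nonneg.2 (Real.smoothTransition.le_one _))
        (sub_nonneg.2 (htan _ ENNReal.toReal_nonneg))
  have hhx : h x = 0 := by
    rw [hhfin x hx]
    simp [tangentGap, r₀]
  have hpos := hS.L_nonneg hh hh0 hhx
  have hfin : ∀ y ∈ V, ρ y ≠ ⊤ := fun y hy => ((hVM y hy).trans ENNReal.coe_lt_top).ne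
  have heq : Set.EqOn h (fun y => (a * (ρ y).toReal + f y) + (Φ r₀ - a * r₀ - c)) V := by
    intro y hy
    have hy' := hfin y hy
    have hle : (ρ y).toReal - M ≤ 0 := by
      have := ENNReal.toReal_mono ENNReal.coe_ne_top (hVM y hy).le
      rw [ENNReal.coe_toReal] at this
      linarith
    simp only [hhfin y hy', hfΦ y hy', ψ, tangentGap, Real.smoothTransition.zero_of_nonpos hle]
    ring
  rw [L_congr hVo hV heq b hxV, L_add_const, L_add_smul (hVo.inter (isOpen_regular D))
    (hV.inter (reflStable_regular D)) Set.inter_subset_right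
    (hρ.smooth.mono fun y hy => hfin y hy.1) hf.1.contDiffOn b a ⟨hxV, hxr⟩] at hpos
  linarith

/-- At regular points with `ρ` finite, the chain rule inequality meets the drift condition; at
regular points with `ρ = ⊤`, `f` attains its minimum 0 and the maximum principle applies. Continuity
of `L f` and `H` gives the rest. -/
theorem IsLyapunov.neg_L_le_of_drift (hS : S.IsGeneratedBy D b) (hρ : IsLyapunov D b ρ)
    {C₁ C₂ : ℝ} (hdrift : ∀ x, ρ x ≠ ⊤ →
      L D b (fun y => (ρ y).toReal) x ≤ C₁ - C₂ * (ρ x).toReal)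
    {Φ a : ℝ → ℝ} (hΦ : ContDiffOn ℝ ∞ Φ (Set.Ioi (-1))) {c : ℝ}
    (hΦc : ∀ s, 0 ≤ s → Φ s ≤ c)
    (ha : ∀ r, 0 ≤ r → 0 ≤ a r)
    (htan : ∀ r s, 0 ≤ r → 0 ≤ s → Φ s ≤ Φ r + a r * (s - r))
    {f H : E N →ᵇ ℝ} (hf : IsTest f) (hfΦ : ∀ y, ρ y ≠ ⊤ → f y = c - Φ (ρ y).toReal)
    (hftop : ∀ y, ρ y = ⊤ → f y = 0)
    (hH : ∀ y, ρ y ≠ ⊤ → a (ρ y).toReal * (C₁ - C₂ * (ρ y).toReal) ≤ H y)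
    (hHtop : ∀ y, ρ y = ⊤ → 0 ≤ H y) (y : E N) : -L D b f y ≤ H y := by
  obtain ⟨l, hl⟩ := hS.exists_bcf hf
  have hclosed : IsClosed {y | -l y ≤ H y} := isClosed_le l.continuous.neg H.continuous
  have hsub : regular D ⊆ {y | -l y ≤ H y} := by
    intro x hx
    change -l x ≤ H x
    rw [hl]
    by_cases hx' : ρ x = ⊤
    · have h0 : ∀ y, 0 ≤ f y := fun y => by
        by_cases hy : ρ y = ⊤
        · rw [hftop y hy]
        · rw [hfΦ y hy]
          exact sub_nonneg.2 (hΦc _ ENNReal.toReal_nonneg)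
      have := hS.L_nonneg hf h0 (hftop x hx')
      linarith [hHtop x hx']
    · refine (hρ.neg_L_le hS hx' hx hΦ (fun s hs => htan _ s ENNReal.toReal_nonneg hs) hf
        hfΦ).trans (le_trans ?_ (hH x hx'))
      exact mul_le_mul_of_nonneg_left (hdrift x hx') (ha _ ENNReal.toReal_nonneg)
  have := hclosed.closure_subset_iff.2 hsub ((dense_regular D) y)
  rw [← hl]
  exact this

theorem sqrt_one_add_tangent {r s : ℝ} (hr : 0 ≤ r) (hs : 0 ≤ s) :
    √(1 + s) - √(1 + r) ≤ (s - r) / (2 * √(1 + r)) := by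
  have h1 : 0 < √(1 + r) := Real.sqrt_pos.2 (by linarith)
  rw [le_div_iff₀ (by positivity)]
  nlinarith [sq_nonneg (√(1 + s) - √(1 + r)), Real.sq_sqrt (show 0 ≤ 1 + r by linarith),
    Real.sq_sqrt (show 0 ≤ 1 + s by linarith)]

/-! ### The uniform moment bound. -/

/-- Uniform in time tightness: functions dominated by `√(1 + ρ)` have bounded mean. -/
theorem IsLyapunov.exists_bound (hS : S.IsGeneratedBy D b) (hρ : IsLyapunov D b ρ) {x : E N}
    (hx : ρ x ≠ ⊤) : ∃ B : ℝ, ∀ (t : ℝ≥0) (f : E N →ᵇ ℝ),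
      (∀ y, ρ y ≠ ⊤ → f y ≤ √(1 + (ρ y).toReal)) → S.P t f x ≤ B := by
  obtain ⟨C₁, C₂, hC₁, hC₂, hdrift⟩ := hρ.drift
  obtain ⟨θ, θ', m, hθ, hmono, hθ1, hθ'1, hθm, hθ'01, htan⟩ := exists_concave_truncation
  have hθle : ∀ z, θ z ≤ m := fun z => by
    rw [← hθm _ (le_max_right z 2)]; exact hmono (le_max_left _ _)
  have hm1 : 1 ≤ m := by
    have := hθle 1; rwa [hθ1 1 le_rfl] at this
  have hθge : ∀ z, 1 ≤ z → 1 ≤ θ z := fun z hz => by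
    have := hmono hz; rwa [hθ1 1 le_rfl] at this
  have hθ0 : ∀ z, 0 ≤ z → 0 ≤ θ z := fun z hz => by
    have := hmono hz; rwa [hθ1 0 zero_le_one] at this
  -- With `q = √(1 + r)`, `(C₁ - C₂ r)/(2q) = (C₁ + C₂)/(2q) - (C₂/2) q`, and `q ≥ 1`. This dictates
  -- `lam` and `A`.
  set lam : ℝ := C₂ / 2 with hlam
  have hlam0 : 0 < lam := by positivity
  set A : ℝ := (C₁ + C₂) / 2 with hA
  set r₀ := (ρ x).toReal with hr₀
  have hr₀0 : 0 ≤ r₀ := ENNReal.toReal_nonneg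
  refine ⟨√(1 + r₀) + A / lam, fun t f hf => ?_⟩
  have hkey : ∀ n : ℝ, 1 ≤ n → ‖f‖ ≤ n →
      S.P t f x ≤ √(1 + r₀) + (A + lam * m / n * (1 + r₀ + C₁ * t)) / lam := by
    intro n hn1 hfn
    have hn0 : 0 < n := by linarith
    have hn2 : 0 < n ^ 2 := by positivity
    have hquot : ∀ r : ℝ, n ^ 2 * (r / n ^ 2) = r := fun r => by field_simp
    -- the linear truncation
    obtain ⟨fv, hfv, hfvfin, hfvtop⟩ := hρ.exists_test
      (Ψ := fun r => n ^ 2 * m - n ^ 2 * θ ((1 + r) / n ^ 2)) (M := 2 * n ^ 2)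
      (ContDiff.contDiffOn (by fun_prop)) fun r hr => by
        rw [hθm _ ((le_div_iff₀ hn2).2 (by linarith))]; ring
    let v : E N →ᵇ ℝ := BoundedContinuousFunction.const (E N) (n ^ 2 * m) - fv
    have hv : ∀ y, v y = n ^ 2 * m - fv y := fun y => rfl
    have hvfin : ∀ y, ρ y ≠ ⊤ → v y = n ^ 2 * θ ((1 + (ρ y).toReal) / n ^ 2) := fun y hy => by
      rw [hv, hfvfin y hy]; ring
    have hvtop : ∀ y, ρ y = ⊤ → v y = n ^ 2 * m := fun y hy => by rw [hv, hfvtop y hy]; ring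
    have hvL : ∀ y, -L D b fv y ≤ BoundedContinuousFunction.const (E N) C₁ y := by
      refine hρ.neg_L_le_of_drift hS hdrift (Φ := fun r => n ^ 2 * θ ((1 + r) / n ^ 2))
        (a := fun r => θ' ((1 + r) / n ^ 2)) (ContDiff.contDiffOn (by fun_prop))
        (fun s _ => mul_le_mul_of_nonneg_left (hθle _) hn2.le) (fun r _ => (hθ'01 _).1) ?_
        hfv hfvfin hfvtop ?_ (fun y _ => hC₁)
      · intro r s _ _
        have h1 := mul_le_mul_of_nonneg_left (htan ((1 + r) / n ^ 2) ((1 + s) / n ^ 2)) hn2.le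
        refine h1.trans_eq ?_
        field_simp
        ring
      · intro y _
        have h1 := hθ'01 ((1 + (ρ y).toReal) / n ^ 2)
        have h2 : 0 ≤ C₂ * (ρ y).toReal := mul_nonneg hC₂.le ENNReal.toReal_nonneg
        change _ ≤ C₁
        nlinarith
    -- No decay survives this truncation, so the bound grows with `t`; it will carry the weight `lam
    -- * m / n`.
    have hPv : ∀ s ≤ t, S.P s v x ≤ 1 + r₀ + C₁ * t := by
      intro s hs
      have h1 := hS.le_gronwallBound hfv hv hvL s x 0 C₁ (fun s' _ => by
        rw [S.P_const_apply]; simp)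
      rw [gronwallBound_K0] at h1
      have h2 : v x ≤ 1 + r₀ := by
        rw [hvfin x hx]
        have := mul_le_mul_of_nonneg_left (htan 0 ((1 + r₀) / n ^ 2)) hn2.le
        rw [hθ1 0 zero_le_one, hθ'1 0 zero_le_one] at this
        simpa [hquot] using this
      have h3 : C₁ * (s : ℝ) ≤ C₁ * t := mul_le_mul_of_nonneg_left (by exact_mod_cast hs) hC₁
      simp only at h1
      linarith
    -- the truncated square root
    have hsq : ContDiffOn ℝ ∞ (fun r : ℝ => √(1 + r)) (Set.Ioi (-1)) :=
      ContDiffOn.sqrt (ContDiff.contDiffOn (by fun_prop)) fun r hr => by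
        have : -1 < r := hr
        linarith
    have hΦ : ContDiffOn ℝ ∞ (fun r => n * θ (√(1 + r) / n)) (Set.Ioi (-1)) :=
      contDiffOn_const.mul (hθ.comp_contDiffOn (hsq.div_const n))
    obtain ⟨fu, hfu, hfufin, hfutop⟩ := hρ.exists_test
      (Ψ := fun r => n * m - n * θ (√(1 + r) / n)) (M := (2 * n) ^ 2)
      (contDiffOn_const.sub hΦ) fun r hr => by
        rw [hθm _ ((le_div_iff₀ hn0).2 (Real.le_sqrt_of_sq_le (by linarith)))]; ring
    let u : E N →ᵇ ℝ := BoundedContinuousFunction.const (E N) (n * m) - fu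
    have hu : ∀ y, u y = n * m - fu y := fun y => rfl
    have hufin : ∀ y, ρ y ≠ ⊤ → u y = n * θ (√(1 + (ρ y).toReal) / n) := fun y hy => by
      rw [hu, hfufin y hy]; ring
    have hutop : ∀ y, ρ y = ⊤ → u y = n * m := fun y hy => by rw [hu, hfutop y hy]; ring
    -- Where `√(1 + ρ) > n` the term `-lam • u` is no longer supplied by the drift, but there `u ≤ n
    -- m` and `v ≥ n²`, so the `v` term compensates it.
    let H : E N →ᵇ ℝ := BoundedContinuousFunction.const (E N) A + (lam * m / n) • v - lam • u
    have hH : ∀ y, H y = A + lam * m / n * v y - lam * u y := fun y => rfl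
    have huL : ∀ y, -L D b fu y ≤ H y := by
      refine hρ.neg_L_le_of_drift hS hdrift
        (a := fun r => θ' (√(1 + r) / n) / (2 * √(1 + r))) hΦ
        (fun s _ => mul_le_mul_of_nonneg_left (hθle _) hn0.le)
        (fun r _ => div_nonneg (hθ'01 _).1 (by positivity)) ?_ hfu hfufin hfutop ?_ ?_
      · intro r s hr hs
        have h1 := mul_le_mul_of_nonneg_left (htan (√(1 + r) / n) (√(1 + s) / n)) hn0.le
        have h2 := mul_le_mul_of_nonneg_left (sqrt_one_add_tangent hr hs)
          (hθ'01 (√(1 + r) / n)).1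
        have h3 : n * (θ (√(1 + r) / n) + θ' (√(1 + r) / n) * (√(1 + s) / n - √(1 + r) / n)) =
            n * θ (√(1 + r) / n) + θ' (√(1 + r) / n) * (√(1 + s) - √(1 + r)) := by field_simp
        rw [h3] at h1
        refine h1.trans (add_le_add_right (h2.trans_eq ?_) _)
        ring
      · intro y hy
        have hy0 : 0 ≤ (ρ y).toReal := ENNReal.toReal_nonneg
        rw [hH, hufin y hy, hvfin y hy]
        set r := (ρ y).toReal
        set q := √(1 + r) with hq
        have hq2 : q ^ 2 = 1 + r := Real.sq_sqrt (by linarith)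
        have hq1 : 1 ≤ q := Real.one_le_sqrt.2 (by linarith)
        have hv0 : 0 ≤ θ ((1 + r) / n ^ 2) := hθ0 _ (by positivity)
        have hrest : lam * m / n * (n ^ 2 * θ ((1 + r) / n ^ 2)) =
            lam * m * n * θ ((1 + r) / n ^ 2) := by field_simp
        rw [hrest]
        rcases le_or_gt q n with hqn | hqn
        · have hz : q / n ≤ 1 := (div_le_one hn0).2 hqn
          rw [hθ1 _ hz, hθ'1 _ hz, mul_div_cancel₀ _ hn0.ne']
          have h1 : 1 / (2 * q) * (C₁ - C₂ * r) = (C₁ + C₂) / (2 * q) - lam * q := by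
            rw [show r = q ^ 2 - 1 by linarith, hlam]; field_simp; ring
          have h2 : (C₁ + C₂) / (2 * q) ≤ A := by
            rw [hA]; exact div_le_div_of_nonneg_left (by linarith) (by norm_num) (by linarith)
          have h3 : 0 ≤ lam * m * n * θ ((1 + r) / n ^ 2) := by positivity
          linarith
        · have h1 : 1 ≤ θ ((1 + r) / n ^ 2) := hθge _ ((one_le_div hn2).2 (by nlinarith))
          have h2 := hθle (q / n)
          have h3 := hθ'01 (q / n)
          have h4 : 0 ≤ θ' (q / n) / (2 * q) := div_nonneg h3.1 (by positivity)
          have h5 : θ' (q / n) / (2 * q) ≤ 1 / 2 :=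
            div_le_div₀ zero_le_one h3.2 (by norm_num) (by linarith)
          have h6 : θ' (q / n) / (2 * q) * (C₁ - C₂ * r) ≤ A := by
            have e1 : 0 ≤ θ' (q / n) / (2 * q) * (C₂ * r) := by positivity
            have e2 := mul_le_mul_of_nonneg_right h5 hC₁
            rw [hA]; linarith
          have h7 : lam * (n * θ (q / n)) ≤ lam * m * n := by
            have := mul_le_mul_of_nonneg_left h2 (mul_pos hlam0 hn0).le
            linarith
          have h8 : lam * m * n * 1 ≤ lam * m * n * θ ((1 + r) / n ^ 2) :=
            mul_le_mul_of_nonneg_left h1 (by positivity)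
          linarith
      · intro y hy
        rw [hH, hutop y hy, hvtop y hy]
        have e : lam * m / n * (n ^ 2 * m) = lam * (n * m) * m := by field_simp
        have e2 : lam * (n * m) * 1 ≤ lam * (n * m) * m :=
          mul_le_mul_of_nonneg_left hm1 (by positivity)
        have e3 : 0 ≤ A := by positivity
        rw [e]
        linarith
    have hPu := hS.le_gronwallBound hfu hu huL t x (-lam) (A + lam * m / n * (1 + r₀ + C₁ * t))
      (fun s hs => by
        have e : S.P s H x = A + lam * m / n * S.P s v x - lam * S.P s u x := by
          simp only [H, map_sub, map_add, map_smul]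
          simp [S.P_const_apply]
        have := mul_le_mul_of_nonneg_left (hPv s hs) (show 0 ≤ lam * m / n by positivity)
        rw [e]
        linarith)
    rw [gronwallBound_of_K_ne_0 (neg_ne_zero.2 hlam0.ne')] at hPu
    have hux : u x ≤ √(1 + r₀) := by
      rw [hufin x hx]
      have := mul_le_mul_of_nonneg_left (htan 0 (√(1 + r₀) / n)) hn0.le
      rw [hθ1 0 zero_le_one, hθ'1 0 zero_le_one] at this
      have e : n * (√(1 + r₀) / n) = √(1 + r₀) := by field_simp
      simpa [e] using this
    have hfu' : S.P t f x ≤ S.P t u x := by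
      refine S.mono t (fun y => ?_) x
      have hfy : f y ≤ n := (le_abs_self _).trans ((f.norm_coe_le_norm y).trans hfn)
      by_cases hy : ρ y = ⊤
      · rw [hutop y hy]; nlinarith
      · rw [hufin y hy]
        rcases le_or_gt (√(1 + (ρ y).toReal)) n with hqn | hqn
        · rw [hθ1 _ ((div_le_one hn0).2 hqn), mul_div_cancel₀ _ hn0.ne']
          exact hf y hy
        · have := hθge _ ((one_le_div hn0).2 hqn.le)
          nlinarith
    refine hfu'.trans (hPu.trans ?_)
    set ε := A + lam * m / n * (1 + r₀ + C₁ * t)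
    have hε : 0 ≤ ε := by positivity
    set w := Real.exp (-lam * t)
    have hw0 : 0 < w := Real.exp_pos _
    have hw1 : w ≤ 1 := Real.exp_le_one_iff.2 (by
      have : 0 ≤ lam * (t : ℝ) := by positivity
      linarith)
    have e1 : ε / -lam * (w - 1) = ε / lam * (1 - w) := by field_simp; ring
    have e2 : ε / lam * (1 - w) ≤ ε / lam * 1 :=
      mul_le_mul_of_nonneg_left (by linarith) (by positivity)
    have e3 : u x * w ≤ √(1 + r₀) * 1 := mul_le_mul hux hw1 hw0.le (Real.sqrt_nonneg _)
    simp only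
    rw [e1]
    linarith
  -- At fixed `t` the truncation level goes to infinity; the `t`-dependent error is `O(1/n)`, so the
  -- limiting bound is uniform in `t`.
  have hlim : Tendsto (fun n : ℝ => √(1 + r₀) + (A + lam * m / n * (1 + r₀ + C₁ * t)) / lam) atTop
      (𝓝 (√(1 + r₀) + (A + 0 * (1 + r₀ + C₁ * t)) / lam)) :=
    (((tendsto_const_nhds.div_atTop tendsto_id).mul_const _).const_add A |>.div_const lam).const_add _
  rw [zero_mul, add_zero] at hlim
  refine ge_of_tendsto hlim ?_
  filter_upwards [eventually_ge_atTop 1, eventually_ge_atTop ‖f‖] with n h1 h2 using hkey n h1 h2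


/-! ### From the Dunkl gradient to Lipschitz bounds. -/

/-- Mean value inequality along the segment from `σ_α x` to `x`, of length `|⟨α, x⟩| |α|`, which
stays in the ball. -/
theorem abs_diffQuot_le {α : E N} (hα : ‖α‖ ^ 2 = 2) {h : E N → ℝ} (hh : ContDiff ℝ 1 h) {r C : ℝ}
    (hC : ∀ y ∈ Metric.closedBall (0 : E N) r, ‖fderiv ℝ h y‖ ≤ C) {x : E N}
    (hx : x ∈ Metric.closedBall (0 : E N) r) : |diffQuot α h x| ≤ C * ‖α‖ := by
  by_cases h0 : inner ℝ α x = 0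
  · rw [diffQuot, if_pos h0, ← Real.norm_eq_abs]
    exact ContinuousLinearMap.le_of_opNorm_le _ (hC x hx) α
  · rw [diffQuot, if_neg h0, abs_div, div_le_iff₀ (abs_pos.2 h0)]
    have hrx : refl α x ∈ Metric.closedBall (0 : E N) r := by simpa using hx
    have := (convex_closedBall (0 : E N) r).norm_image_sub_le_of_norm_fderiv_le (𝕜 := ℝ)
      (fun y _ => (hh.differentiable (by simp)).differentiableAt) hC hrx hx
    rw [refl_apply hα, sub_sub_cancel, norm_smul, Real.norm_eq_abs, Real.norm_eq_abs] at this
    rw [refl_apply hα]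
    linarith

theorem fderiv_apply_eq_sum_T (D : RootData N) (h : E N → ℝ) (x v : E N) :
    fderiv ℝ h x v = ∑ i, v i * T D i h x -
      ∑ α ∈ D.Rplus, D.k α * inner ℝ α v * diffQuot α h x := by
  have hv : v = ∑ i, v i • EuclideanSpace.single i (1 : ℝ) := by
    conv_lhs => rw [← (EuclideanSpace.basisFun (Fin N) ℝ).sum_repr v]
    simp
  have h1 : fderiv ℝ h x v = ∑ i, v i * fderiv ℝ h x (EuclideanSpace.single i 1) := by
    conv_lhs => rw [hv]
    simp
  have h2 : ∀ α : E N, inner ℝ α v = ∑ i, v i * α i := fun α => by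
    rw [PiLp.inner_apply]; simp
  simp only [T, mul_add, Finset.sum_add_distrib, Finset.mul_sum]
  rw [Finset.sum_comm (s := Finset.univ), h1, eq_sub_iff_add_eq]
  congr 1
  refine Finset.sum_congr rfl fun α _ => ?_
  rw [h2, Finset.mul_sum, Finset.sum_mul]
  refine Finset.sum_congr rfl fun i _ => ?_
  ring

/-- For `γ < 1/2` the Dunkl gradient controls the gradient. -/
theorem norm_fderiv_le {D : RootData N} (hγ : D.gamma < 1 / 2) {h : E N → ℝ} (hh : ContDiff ℝ 1 h)
    {C : ℝ} (hC0 : 0 ≤ C) (hC : ∀ x, ∑ i, T D i h x ^ 2 ≤ C ^ 2) (x : E N) :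
    ‖fderiv ℝ h x‖ ≤ C / (1 - 2 * D.gamma) := by
  -- Maximising over a ball, convex and reflection invariant, bounds the difference quotients at `z`
  -- by the gradient norm at `z` itself.
  obtain ⟨z, hz, hmax⟩ := (isCompact_closedBall (0 : E N) ‖x‖).exists_isMaxOn
    ⟨x, by simp⟩ (hh.continuous_fderiv (by simp)).norm.continuousOn
  set s := ‖fderiv ℝ h z‖ with hs
  have hs0 : 0 ≤ s := norm_nonneg _
  have hx : ‖fderiv ℝ h x‖ ≤ s := hmax (show x ∈ Metric.closedBall (0 : E N) ‖x‖ by simp)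
  have hγ0 : 0 ≤ D.gamma := Finset.sum_nonneg fun α hα => D.k_nonneg_of_mem hα
  have hle : s ≤ C + 2 * D.gamma * s := by
    refine ContinuousLinearMap.opNorm_le_bound _ (by positivity) fun v => ?_
    rw [fderiv_apply_eq_sum_T D, Real.norm_eq_abs]
    have h1 : |∑ i, v i * T D i h z| ≤ C * ‖v‖ := by
      refine abs_le_of_sq_le_sq ?_ (by positivity)
      refine (Finset.sum_mul_sq_le_sq_mul_sq _ _ _).trans ?_
      rw [mul_pow, EuclideanSpace.norm_sq_eq, mul_comm]
      simp only [Real.norm_eq_abs, sq_abs]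
      exact mul_le_mul_of_nonneg_right (hC z) (Finset.sum_nonneg fun i _ => sq_nonneg _)
    have h2 : |∑ α ∈ D.Rplus, D.k α * inner ℝ α v * diffQuot α h z| ≤
        2 * D.gamma * s * ‖v‖ := by
      refine (Finset.abs_sum_le_sum_abs _ _).trans ?_
      rw [RootData.gamma, Finset.mul_sum, Finset.sum_mul, Finset.sum_mul]
      refine Finset.sum_le_sum fun α hα => ?_
      have hα2 := D.norm_sq_of_mem hα
      have hk := D.k_nonneg_of_mem hα
      have e1 := abs_diffQuot_le hα2 hh (fun y hy => hmax hy) hz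
      have e2 := abs_real_inner_le_norm α v
      rw [abs_mul, abs_mul, abs_of_nonneg hk]
      calc D.k α * |inner ℝ α v| * |diffQuot α h z|
          ≤ D.k α * (‖α‖ * ‖v‖) * (s * ‖α‖) := by
            gcongr
        _ = D.k α * ‖α‖ ^ 2 * s * ‖v‖ := by ring
        _ = 2 * D.k α * s * ‖v‖ := by rw [hα2]; ring
    calc _ ≤ _ := abs_sub _ _
      _ ≤ C * ‖v‖ + 2 * D.gamma * s * ‖v‖ := add_le_add h1 h2
      _ = _ := by ring
  refine hx.trans ((le_div_iff₀ (by linarith)).2 ?_)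
  linarith

/-- Under the gradient bound, `P_t f` is Lipschitz with a constant that decays in `t`. -/
theorem MarkovSemigroup.GradientBound.exists_lipschitz {S : MarkovSemigroup N} {D : RootData N}
    {η : ℝ} (hgrad : S.GradientBound D η) (hγ : D.gamma < 1 / 2) (hη : η < 0) {f : E N →ᵇ ℝ}
    (hf : IsTest f) : ∃ C : ℝ≥0 → ℝ, Tendsto C atTop (𝓝 0) ∧
      ∀ t, 0 < t → ∀ x y, |S.P t f x - S.P t f y| ≤ C t * ‖x - y‖ := by
  obtain ⟨g, hg⟩ := exists_bcf_symGrad D hf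
  refine ⟨fun t => Real.exp (η * t) * √‖g‖ / (1 - 2 * D.gamma), ?_, fun t ht x y => ?_⟩
  · have h1 : Tendsto (fun t : ℝ≥0 => Real.exp (η * t)) atTop (𝓝 0) :=
      Real.tendsto_exp_atBot.comp
        ((NNReal.tendsto_coe_atTop.2 tendsto_id).const_mul_atTop_of_neg hη)
    simpa using (h1.mul_const √‖g‖).div_const (1 - 2 * D.gamma)
  · obtain ⟨hC1, hbound⟩ := hgrad f hf g hg t ht
    have hT : ∀ z, ∑ i, T D i (S.P t f) z ^ 2 ≤ (Real.exp (η * t) * √‖g‖) ^ 2 := by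
      intro z
      have h1 : ∑ i, T D i (S.P t f) z ^ 2 ≤ symGrad D (S.P t f) z :=
        Finset.single_le_sum (f := fun g : D.G => ∑ i, T D i (S.P t f) (g.1 z) ^ 2)
          (fun _ _ => Finset.sum_nonneg fun _ _ => sq_nonneg _) (Finset.mem_univ 1)
      have h2 : S.P t g z ≤ ‖g‖ :=
        S.P_le_of_le t (fun y => (le_abs_self _).trans (g.norm_coe_le_norm y)) z
      refine h1.trans ((hbound z).trans ?_)
      rw [mul_pow, Real.sq_sqrt (norm_nonneg _), ← Real.exp_nat_mul]
      refine (mul_le_mul_of_nonneg_left h2 (Real.exp_pos _).le).trans_eq ?_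
      congr 2
      push_cast
      ring
    rw [← Real.norm_eq_abs]
    exact convex_univ.norm_image_sub_le_of_norm_fderiv_le (𝕜 := ℝ)
      (fun y _ => (hC1.differentiable (by simp)).differentiableAt)
      (fun z _ => norm_fderiv_le hγ hC1 (by positivity) hT z) (Set.mem_univ y) (Set.mem_univ x)

/-! ### Tight functionals as measures. -/

open scoped CompactlySupported


/-- A functional on `C_b` without mass at infinity: it is small on functions which are bounded by a
given constant and small on a suitable compact set. -/
def IsTight (Λ : (E N →ᵇ ℝ) → ℝ) : Prop :=
  ∀ d > 0, ∀ ε > 0, ∃ K : Set (E N), IsCompact K ∧ ∀ (w : E N →ᵇ ℝ) (a : ℝ), 0 ≤ a →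
    (∀ y, |w y| ≤ d) → (∀ y ∈ K, |w y| ≤ a) → |Λ w| ≤ a + ε

theorem exists_cutoff {K : Set (E N)} (hK : IsCompact K) :
    ∃ χ : C_c(E N, ℝ), (∀ x ∈ K, χ x = 1) ∧ ∀ x, 0 ≤ χ x ∧ χ x ≤ 1 := by
  obtain ⟨χ, h1, -, hs, h01⟩ := exists_continuous_one_zero_of_isCompact hK isClosed_empty
    (Set.disjoint_empty K)
  exact ⟨⟨χ, hs⟩, h1, h01⟩

/-- A tight positive normalised functional on `C_b` is integration against a probability
measure. -/
theorem exists_measure_of_isTight (Λ : (E N →ᵇ ℝ) →ₗ[ℝ] ℝ)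
    (hpos : ∀ f : E N →ᵇ ℝ, (∀ x, 0 ≤ f x) → 0 ≤ Λ f)
    (hone : Λ (BoundedContinuousFunction.const (E N) 1) = 1) (htight : IsTight Λ) :
    ∃ ν : Measure (E N), IsProbabilityMeasure ν ∧ ∀ f : E N →ᵇ ℝ, Λ f = ∫ x, f x ∂ν := by
  let Λc : C_c(E N, ℝ) →ₚ[ℝ] ℝ := PositiveLinearMap.mk₀
    { toFun := fun f => Λ f.toBoundedContinuousFunction
      map_add' := fun f g => by rw [← map_add]; congr 1
      map_smul' := fun c f => by rw [RingHom.id_apply, ← map_smul]; congr 1 }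
    (fun f hf => hpos _ hf)
  have hΛc : ∀ f : C_c(E N, ℝ), Λc f = Λ f.toBoundedContinuousFunction := fun f => rfl
  let ν := RealRMK.rieszMeasure Λc
  have hint : ∀ f : C_c(E N, ℝ), ∫ x, f x ∂ν = Λ f.toBoundedContinuousFunction :=
    RealRMK.integral_rieszMeasure Λc
  have hmono : ∀ f g : E N →ᵇ ℝ, (∀ x, f x ≤ g x) → Λ f ≤ Λ g := fun f g h => by
    have := hpos (g - f) fun x => sub_nonneg.2 (h x)
    rwa [map_sub, sub_nonneg] at this
  -- Inner regularity reduces the total mass to compact sets, where cutoffs below 1 bound it.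
  have hmass : ν Set.univ ≤ 1 := by
    rw [isOpen_univ.measure_eq_iSup_isCompact ν]
    refine iSup₂_le fun K _ => iSup_le fun hK => ?_
    obtain ⟨χ, hχK, hχ⟩ := exists_cutoff hK
    refine (RealRMK.rieszMeasure_le_of_eq_one Λc (fun x => (hχ x).1) hK hχK).trans ?_
    rw [← ENNReal.ofReal_one, ← hone, hΛc]
    exact ENNReal.ofReal_le_ofReal (hmono _ _ fun x => (hχ x).2)
  have hfin : IsFiniteMeasure ν := ⟨hmass.trans_lt ENNReal.one_lt_top⟩
  have hmass' : ν.real Set.univ ≤ 1 := ENNReal.toReal_le_of_le_ofReal zero_le_one (by simpa using hmass)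
  have hrep : ∀ f : E N →ᵇ ℝ, Λ f = ∫ x, f x ∂ν := by
    intro f
    -- Both `f - fχ` and `1 - χ` vanish on `K`. Tightness handles the first under `Λ`; the second
    -- shows that `ν` leaves mass at most `ε` under `1 - χ`.
    have hbound : ∀ ε > 0, |Λ f - ∫ x, f x ∂ν| ≤ ε * (1 + ‖f‖) := by
      intro ε hε
      obtain ⟨K, hK, hKw⟩ := htight (‖f‖ + 1) (by positivity) ε hε
      obtain ⟨χ, hχK, hχ⟩ := exists_cutoff hK
      have hχabs : ∀ y, |1 - χ y| ≤ 1 := fun y => by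
        rw [abs_le]; constructor <;> linarith [(hχ y).1, (hχ y).2]
      let fχ : C_c(E N, ℝ) := ⟨⟨fun x => f x * χ x, f.continuous.mul χ.continuous⟩,
        χ.hasCompactSupport.mul_left⟩
      have hfχ : ∀ x, fχ x = f x * χ x := fun x => rfl
      have h1 : |Λ (f - fχ.toBoundedContinuousFunction)| ≤ 0 + ε := by
        refine hKw _ 0 le_rfl (fun y => ?_) fun y hy => ?_
        · change |f y - f y * χ y| ≤ _
          rw [show f y - f y * χ y = f y * (1 - χ y) by ring, abs_mul]
          have e1 : |f y| ≤ ‖f‖ := f.norm_coe_le_norm y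
          have := mul_le_mul e1 (hχabs y) (abs_nonneg _) (norm_nonneg _)
          linarith
        · change |f y - f y * χ y| ≤ _
          simp [hχK y hy]
      have h2 : |Λ (BoundedContinuousFunction.const (E N) 1 - χ.toBoundedContinuousFunction)| ≤
          0 + ε := by
        refine hKw _ 0 le_rfl (fun y => ?_) fun y hy => ?_
        · change |1 - χ y| ≤ _
          linarith [hχabs y, norm_nonneg f]
        · change |1 - χ y| ≤ _
          simp [hχK y hy]
      rw [map_sub, hone, ← hint] at h2
      rw [map_sub, ← hint] at h1
      have hχi : Integrable χ ν := χ.continuous.integrable_of_hasCompactSupport χ.hasCompactSupport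
      have hfχi : Integrable fχ ν :=
        fχ.continuous.integrable_of_hasCompactSupport fχ.hasCompactSupport
      have hfi : Integrable f ν := f.integrable ν
      have h3 : |∫ x, fχ x ∂ν - ∫ x, f x ∂ν| ≤ ‖f‖ * ε := by
        rw [← integral_sub hfχi hfi]
        have e1 : |∫ x, (fχ x - f x) ∂ν| ≤ ∫ x, ‖f‖ * (1 - χ x) ∂ν := by
          rw [← Real.norm_eq_abs]
          refine norm_integral_le_of_norm_le (((integrable_const 1).sub hχi).const_mul _)
            (Eventually.of_forall fun x => ?_)
          rw [hfχ, show f x * χ x - f x = -(f x * (1 - χ x)) by ring, norm_neg, norm_mul,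
            Real.norm_of_nonneg (sub_nonneg.2 (hχ x).2)]
          exact mul_le_mul_of_nonneg_right (f.norm_coe_le_norm x) (sub_nonneg.2 (hχ x).2)
        refine e1.trans ?_
        rw [integral_const_mul, integral_sub (integrable_const 1) hχi]
        refine mul_le_mul_of_nonneg_left ?_ (norm_nonneg _)
        simp only [integral_const, smul_eq_mul, mul_one]
        have := (abs_le.1 h2).2
        linarith
      have h4 : Λ f - ∫ x, f x ∂ν = (Λ f - ∫ x, fχ x ∂ν) + (∫ x, fχ x ∂ν - ∫ x, f x ∂ν) := by ring
      rw [h4]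
      refine (abs_add_le _ _).trans ?_
      linarith
    have hzero : |Λ f - ∫ x, f x ∂ν| ≤ 0 := by
      refine le_of_forall_pos_le_add fun δ hδ => ?_
      have := hbound (δ / (1 + ‖f‖)) (by positivity)
      rwa [div_mul_cancel₀ _ (by positivity), ← zero_add δ] at this
    exact sub_eq_zero.1 (abs_nonpos_iff.1 hzero)
  refine ⟨ν, ⟨?_⟩, hrep⟩
  have h := hrep (BoundedContinuousFunction.const (E N) 1)
  rw [hone] at h
  simp only [BoundedContinuousFunction.const_apply, integral_const, smul_eq_mul, mul_one] at h
  rw [← ENNReal.ofReal_one, h, ofReal_measureReal]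

/-- Cut off, then mollify. The global bound does not depend on `K`, as needed because tightness
fixes the bound before choosing `K`. -/
theorem exists_test_approx (f : E N →ᵇ ℝ) {K : Set (E N)} (hK : IsCompact K) {ε : ℝ} (hε : 0 < ε) :
    ∃ g : E N →ᵇ ℝ, IsTest g ∧ (∀ y ∈ K, |(f - g) y| ≤ ε) ∧ ∀ y, |(f - g) y| ≤ ‖f‖ + ε := by
  obtain ⟨χ, hχK, hχ⟩ := exists_cutoff hK
  obtain ⟨g, hg, hgd, hgs⟩ := (f.continuous.mul χ.continuous).exists_contDiff_approx ⊤
    (ε := fun _ => ε) continuous_const (fun _ => hε)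
  replace hgd : ∀ y, dist (g y) (f y * χ y) < ε := hgd
  have hgc : HasCompactSupport g := (χ.hasCompactSupport.mul_left (f := f)).mono hgs
  obtain ⟨F, hF⟩ := exists_bcf_of_hasCompactSupport hg.continuous hgc
  have hFg : (F : E N → ℝ) = g := funext hF
  refine ⟨F, ⟨by rw [hFg]; exact hg, by rwa [hFg]⟩, fun y hy => ?_, fun y => ?_⟩
  · have := (hgd y).le
    rw [dist_comm, Real.dist_eq, hχK y hy, mul_one] at this
    simpa [hF] using this
  · have h1 := (hgd y).le
    rw [dist_comm, Real.dist_eq] at h1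
    have h2 : |f y - f y * χ y| ≤ ‖f‖ := by
      rw [show f y - f y * χ y = f y * (1 - χ y) by ring, abs_mul,
        abs_of_nonneg (sub_nonneg.2 (hχ y).2)]
      have e1 : |f y| ≤ ‖f‖ := f.norm_coe_le_norm y
      refine (mul_le_mul e1 (sub_le_self _ (hχ y).1) (sub_nonneg.2 (hχ y).2)
        (norm_nonneg _)).trans_eq (mul_one _)
    have h3 : (f - F) y = (f y - f y * χ y) + (f y * χ y - g y) := by
      rw [BoundedContinuousFunction.coe_sub, Pi.sub_apply, hF]; ring
    rw [h3]
    exact (abs_add_le _ _).trans (add_le_add h2 h1)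

/-! ### Tightness, convergence and invariance. -/

namespace MarkovSemigroup

/-- The functionals `f ↦ P_t f x`, `t ≥ 0`, are uniformly tight. -/
def TightAt (S : MarkovSemigroup N) (x : E N) : Prop :=
  ∀ d > 0, ∀ ε > 0, ∃ K : Set (E N), IsCompact K ∧ ∀ (w : E N →ᵇ ℝ) (a : ℝ), 0 ≤ a →
    (∀ y, |w y| ≤ d) → (∀ y ∈ K, |w y| ≤ a) → ∀ t, |S.P t w x| ≤ a + ε

end MarkovSemigroup

theorem IsLyapunov.tightAt (hS : S.IsGeneratedBy D b) (hρ : IsLyapunov D b ρ) {x : E N}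
    (hx : ρ x ≠ ⊤) : S.TightAt x := by
  obtain ⟨B, hB⟩ := hρ.exists_bound hS hx
  intro d hd ε hε
  have hlim : Tendsto (fun q : ℝ => d * B / q) atTop (𝓝 0) :=
    tendsto_const_nhds.div_atTop tendsto_id
  obtain ⟨q, hq, hq1⟩ := ((hlim.eventually (gt_mem_nhds hε)).and (eventually_gt_atTop 1)).exists
  have hq0 : 0 < q := by linarith
  have hM : 0 < q ^ 2 - 1 := by nlinarith
  let M : ℝ≥0 := ⟨q ^ 2 - 1, hM.le⟩
  refine ⟨_, hρ.isCompact_le M hM, fun w a ha hwd hwK t => ?_⟩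
  let W : E N →ᵇ ℝ := BoundedContinuousFunction.ofNormedAddCommGroup (fun y => |w y|)
    w.continuous.abs d fun y => by simpa using hwd y
  have hW : ∀ y, W y = |w y| := fun y => rfl
  -- Scaled so that `F ≤ 0` where `ρ ≤ q² - 1` and `F ≤ q ≤ √(1 + ρ)` at the other finite points;
  -- then `P_t |w| x ≤ a + d B / q`.
  let F : E N →ᵇ ℝ := (q / d) • (W - BoundedContinuousFunction.const (E N) a)
  have hF : ∀ y, F y = q / d * (|w y| - a) := fun y => rfl
  have h1 := hB t F fun y hy => by
    rw [hF]
    by_cases hyM : ρ y ≤ (M : ℝ≥0∞)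
    · refine le_trans ?_ (Real.sqrt_nonneg _)
      exact mul_nonpos_of_nonneg_of_nonpos (by positivity) (sub_nonpos.2 (hwK y hyM))
    · have hlt : q ^ 2 - 1 ≤ (ρ y).toReal := by
        have := ENNReal.toReal_mono hy (not_le.1 hyM).le
        rwa [ENNReal.coe_toReal] at this
      refine le_trans ?_ (Real.le_sqrt_of_sq_le (show q ^ 2 ≤ 1 + (ρ y).toReal by linarith))
      rw [div_mul_eq_mul_div, div_le_iff₀ hd]
      exact mul_le_mul_of_nonneg_left (by linarith [hwd y]) hq0.le
  have h2 : S.P t F x = q / d * (S.P t W x - a) := by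
    simp only [F, map_smul, map_sub]
    simp [S.P_const_apply]
  rw [h2, div_mul_eq_mul_div, div_le_iff₀ hd] at h1
  have h3 : S.P t W x - a ≤ d * B / q := by
    rw [le_div_iff₀ hq0]; linarith
  have h4 := S.abs_P_le t (f := w) (g := W) (fun y => le_rfl) x
  linarith

namespace MarkovSemigroup

/-- Asymptotic flattening of `P_t f` for test functions `f`. -/
def Flattens (S : MarkovSemigroup N) : Prop :=
  ∀ f : E N →ᵇ ℝ, IsTest f → ∃ C : ℝ≥0 → ℝ, Tendsto C atTop (𝓝 0) ∧
    ∀ t, 0 < t → ∀ x y, |S.P t f x - S.P t f y| ≤ C t * ‖x - y‖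

theorem TightAt.exists_test_approx {x y : E N} (hx : S.TightAt x) (hy : S.TightAt y)
    (f : E N →ᵇ ℝ) {ε : ℝ} (hε : 0 < ε) : ∃ g : E N →ᵇ ℝ, IsTest g ∧
      ∀ t, |S.P t f x - S.P t g x| ≤ ε ∧ |S.P t f y - S.P t g y| ≤ ε := by
  have hd : 0 < ‖f‖ + ε / 2 := by positivity
  obtain ⟨K₁, hK₁, h₁⟩ := hx _ hd (ε / 2) (half_pos hε)
  obtain ⟨K₂, hK₂, h₂⟩ := hy _ hd (ε / 2) (half_pos hε)
  obtain ⟨g, hg, hgK, hgd⟩ := Dunkl.exists_test_approx f (hK₁.union hK₂) (half_pos hε)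
  refine ⟨g, hg, fun t => ⟨?_, ?_⟩⟩
  · have := h₁ (f - g) (ε / 2) (half_pos hε).le hgd (fun z hz => hgK z (.inl hz)) t
    rw [map_sub, add_halves] at this
    exact this
  · have := h₂ (f - g) (ε / 2) (half_pos hε).le hgd (fun z hz => hgK z (.inr hz)) t
    rw [map_sub, add_halves] at this
    exact this

/-- Subtracting the constant `P_t f x` leaves a function that is small on a compact set for large
`t`; applying `P_{s'}` at `x` keeps it small by tightness, uniformly in `s'`. -/
theorem Flattens.cauchySeq_test (hfl : S.Flattens) {x : E N} (hx : S.TightAt x) {f : E N →ᵇ ℝ}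
    (hf : IsTest f) : CauchySeq fun t : ℝ≥0 => S.P t f x := by
  obtain ⟨C, hC, hlip⟩ := hfl f hf
  rw [Metric.cauchySeq_iff']
  intro ε hε
  obtain ⟨K, hK, hKw⟩ := hx (2 * ‖f‖ + 1) (by positivity) (ε / 3) (by positivity)
  obtain ⟨r, hr⟩ := hK.isBounded.subset_closedBall x
  have hlim : Tendsto (fun t => C t * max r 0) atTop (𝓝 0) := by
    simpa using hC.mul_const (max r 0)
  obtain ⟨t, ht, ht0⟩ := ((hlim.eventually (gt_mem_nhds (show 0 < ε / 3 by positivity))).and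
    (eventually_gt_atTop 0)).exists
  refine ⟨t, fun s hs => ?_⟩
  obtain ⟨s', rfl⟩ : ∃ s', s = s' + t := ⟨s - t, (tsub_add_cancel_of_le hs).symm⟩
  let w : E N →ᵇ ℝ := S.P t f - BoundedContinuousFunction.const (E N) (S.P t f x)
  have hw : ∀ y, w y = S.P t f y - S.P t f x := fun y => rfl
  have hPf : ∀ y, |S.P t f y| ≤ ‖f‖ := fun y =>
    S.abs_P_le_of_abs_le t (fun z => f.norm_coe_le_norm z) y
  have h1 := hKw w (ε / 3) (by positivity) (fun y => by
      rw [hw]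
      refine (abs_sub _ _).trans ?_
      linarith [hPf y, hPf x]) (fun y hy => by
      rw [hw]
      have e1 : ‖y - x‖ ≤ max r 0 := by
        have := hr hy
        rw [Metric.mem_closedBall, dist_eq_norm] at this
        exact this.trans (le_max_left _ _)
      have e2 := hlip t ht0 y x
      rcases le_total 0 (C t) with hc | hc
      · exact e2.trans ((mul_le_mul_of_nonneg_left e1 hc).trans ht.le)
      · refine e2.trans ((mul_nonpos_of_nonpos_of_nonneg hc (norm_nonneg _)).trans ?_)
        positivity) s'
  have h2 : S.P s' w x = S.P (s' + t) f x - S.P t f x := by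
    simp only [w, map_sub, S.add]
    simp [S.P_const_apply]
  rw [h2] at h1
  rw [Real.dist_eq]
  linarith

theorem Flattens.cauchySeq (hfl : S.Flattens) {x : E N} (hx : S.TightAt x) (f : E N →ᵇ ℝ) :
    CauchySeq fun t : ℝ≥0 => S.P t f x := by
  rw [Metric.cauchySeq_iff']
  intro ε hε
  obtain ⟨g, hg, hfg⟩ := hx.exists_test_approx hx f (ε := ε / 4) (by positivity)
  obtain ⟨t, ht⟩ := Metric.cauchySeq_iff'.1 (hfl.cauchySeq_test hx hg) (ε / 4) (by positivity)
  refine ⟨t, fun s hs => ?_⟩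
  have h1 := ht s hs
  rw [Real.dist_eq, abs_lt] at *
  have h2 := abs_le.1 (hfg s).1
  have h3 := abs_le.1 (hfg t).1
  constructor <;> linarith

theorem Flattens.tendsto_sub (hfl : S.Flattens) {x y : E N} (hx : S.TightAt x) (hy : S.TightAt y)
    (f : E N →ᵇ ℝ) : Tendsto (fun t : ℝ≥0 => S.P t f x - S.P t f y) atTop (𝓝 0) := by
  rw [Metric.tendsto_nhds]
  intro ε hε
  obtain ⟨g, hg, hfg⟩ := hx.exists_test_approx hy f (ε := ε / 4) (by positivity)
  obtain ⟨C, hC, hlip⟩ := hfl g hg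
  have hlim : Tendsto (fun t => C t * ‖x - y‖) atTop (𝓝 0) := by
    simpa using hC.mul_const ‖x - y‖
  filter_upwards [hlim.eventually (gt_mem_nhds (show 0 < ε / 4 by positivity)),
    eventually_gt_atTop 0] with t ht ht0
  have h1 := abs_le.1 ((hlip t ht0 x y).trans ht.le)
  have h2 := abs_le.1 (hfg t).1
  have h3 := abs_le.1 (hfg t).2
  rw [Real.dist_eq, sub_zero, abs_lt]
  constructor <;> linarith

/-- A Markov semigroup which flattens test functions and is uniformly tight at some point `x₀`
converges to an invariant probability measure at every point where it is uniformly tight. -/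
theorem Flattens.exists_invariant (hfl : S.Flattens) {x₀ : E N} (hx₀ : S.TightAt x₀) :
    ∃ ν : Measure (E N), IsProbabilityMeasure ν ∧
      (∀ (f : E N →ᵇ ℝ) (x : E N), S.TightAt x →
        Tendsto (fun t : ℝ≥0 => S.P t f x) atTop (𝓝 (∫ y, f y ∂ν))) ∧ S.IsInvariant ν := by
  choose Λ hΛ using fun f => cauchySeq_tendsto_of_complete (hfl.cauchySeq hx₀ f)
  have huniq : ∀ {f : E N →ᵇ ℝ} {c : ℝ},
      Tendsto (fun t : ℝ≥0 => S.P t f x₀) atTop (𝓝 c) → Λ f = c :=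
    fun h => tendsto_nhds_unique (hΛ _) h
  let Λl : (E N →ᵇ ℝ) →ₗ[ℝ] ℝ :=
    { toFun := Λ
      map_add' := fun f g => huniq (by simpa using (hΛ f).add (hΛ g))
      map_smul' := fun c f => huniq (by simpa using (hΛ f).const_mul c) }
  obtain ⟨ν, hν, hrep⟩ := exists_measure_of_isTight Λl
    (fun f hf => ge_of_tendsto' (hΛ f) fun t => S.nonneg t f hf x₀)
    (huniq (by simp only [S.P_const_apply]; exact tendsto_const_nhds))
    (fun d hd ε hε => by
      obtain ⟨K, hK, hKw⟩ := hx₀ d hd ε hε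
      exact ⟨K, hK, fun w a ha h1 h2 =>
        le_of_tendsto' (hΛ w).abs fun t => hKw w a ha h1 h2 t⟩)
  refine ⟨ν, hν, fun f x hx => ?_, fun t f => ?_⟩
  · rw [← hrep]
    have := (hfl.tendsto_sub hx hx₀ f).add (hΛ f)
    simp only [sub_add_cancel, zero_add] at this
    exact this
  · rw [← hrep, ← hrep]
    refine huniq ?_
    -- The limit functional at `P_t f` is the limit of `P_{s+t} f x₀` in `s`: the same orbit,
    -- shifted.
    simp only [← S.add]
    exact (hΛ f).comp (tendsto_atTop_mono (fun s => le_self_add) tendsto_id)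

end MarkovSemigroup

end Dunkl

end

theorem theorem3p2 {N : ℕ} (D : Dunkl.RootData N) (b : Dunkl.E N → Dunkl.E N)
    (hb : ContDiff ℝ 1 b) (S : Dunkl.MarkovSemigroup N) (hS : S.IsGeneratedBy D b)
    (hγ : D.gamma < 1 / 2) (η : ℝ) (hη : η < 0) (hgrad : S.GradientBound D η)
    (ρ : Dunkl.E N → ℝ≥0∞) (hρ : Dunkl.IsLyapunov D b ρ) :
    ∃ (t : ℕ → ℝ≥0) (ν : Measure (Dunkl.E N)), Tendsto t atTop atTop ∧
      IsProbabilityMeasure ν ∧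
      (∀ (f : Dunkl.E N →ᵇ ℝ) (x : Dunkl.E N), ρ x ≠ ⊤ →
        Tendsto (fun l => S.P (t l) f x) atTop (𝓝 (∫ y, f y ∂ν))) ∧
      S.IsInvariant ν := by
  obtain ⟨x₀, hx₀⟩ := hρ.exists_ne_top
  have hfl : S.Flattens := fun f hf => hgrad.exists_lipschitz hγ hη hf
  obtain ⟨ν, hν, hconv, hinv⟩ := hfl.exists_invariant (hρ.tightAt hS hx₀)
  -- Convergence holds along all `t → ∞`, so the integers serve as the sequence.
  exact ⟨fun l => l, ν, tendsto_natCast_atTop_atTop, hν,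
    fun f x hx => (hconv f x (hρ.tightAt hS hx)).comp tendsto_natCast_atTop_atTop, hinv⟩
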